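/- A plane bipolar orientation is a non-separable planar map (a connected graph embedded in the sphere, up to orientation-preserving homeomorphism, in which no vertex is incident twice to the same face) with at least two edges, rooted at one of its corners and drawn in the plane so that the root corner lies in the outer face, endowed with an acyclic orientation that has a single source and a single sink, such that the sink is the root vertex and the source is the other end of the root edge (the edge that follows the root corner in clockwise order around the root vertex). A blossoming tree is a plane tree whose corners can carry opening and closing stems. A local closure of a blossoming map merges an opening stem with the following closing stem, no other stem lying in between, in clockwise order around the border of the outer face; it creates an edge oriented from the vertex of the opening stem to the vertex of the closing stem, with the new bounded face on its right. The closure is obtained by performing local closures as long as possible. The blossoming tree of a plane bipolar orientation $M$ is the blossoming tree, rooted at the root corner of $M$ and with its edges oriented so that every vertex has an oriented path to the root vertex, whose closure is $M$. The contour word of a rooted blossoming tree is the word on the alphabet $\{e,\bar e,b,\bar b\}$ read along the clockwise contour of the tree starting at the root corner, where $e$ and $\bar e$ encode respectively the first and the second exploration of an edge, and $b$ and $\bar b$ the exploration of an opening and of a closing stem. Lemma. A word $w$ on the alphabet $\{e,\bar e,b,\bar b\}$ is the contour word of the blossoming tree of some plane bipolar orientation if and only if the following five conditions hold (letters of $w$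 are numbered from $1$): (1) $w_1=e$ and $w_2=b$; (2) the restriction of $w$ to $\{e,\bar e\}$ is a Dyck word; (3) the restriction of $w$ to $\{b,\bar b\}$ is a Dyck word; (4) for all $i<j$, if $w_i=b$ and $w_j=\bar b$, there exists $k\in[i,j]$ such that $w_k=\bar e$; (5) for all $1<i<j$, if $w_i=e$ and $w_j=\bar e$, there exists $k\in[i,j]$ such that $w_k=\bar b$. -/

import Mathlib

/-- A blossoming plane map (connected, embedded in the plane, with an orientation of its edges),
encoded by its darts (half-edges).  Stems are single darts, fixed by `opp`; an edge is a pair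
`{d, opp d}` of distinct darts.  A map without stems is an ordinary oriented plane map. -/
structure BlossomingMap (D : Type) [Fintype D] [DecidableEq D] where
  /-- the next dart in clockwise order around the same vertex -/
  rot : Equiv.Perm D
  /-- the other half of the edge containing the dart; the dart itself if it is a stem -/
  opp : Equiv.Perm D
  opp_opp : ∀ d, opp (opp d) = d
  /-- the dart is directed away from its vertex; a stem is opening if `out` holds, and closing
  otherwise -/
  out : D → Prop
  /-- every edge gets exactly one direction -/
  out_opp : ∀ d, opp d ≠ d → (out (opp d) ↔ ¬ out d)
  /-- a dart that has the outer face on its left -/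
  outer : D
  /-- stems lie in the outer face -/
  stem_outer : ∀ d, opp d = d → (rot * opp).SameCycle outer d
  /-- the map is connected -/
  connected : ∀ d d', Relation.ReflTransGen (fun x y => y = rot x ∨ y = opp x) d d'
  /-- the map has genus zero: `#vertices + #faces = #edges + 2`
  (every edge has exactly one outgoing half) -/
  euler : Nat.card (Quotient (Equiv.Perm.SameCycle.setoid rot))
      + Nat.card (Quotient (Equiv.Perm.SameCycle.setoid (rot * opp)))
      = Nat.card {d : D // opp d ≠ d ∧ out d} + 2

namespace BlossomingMap

variable {D : Type} [Fintype D] [DecidableEq D] (B : BlossomingMap D)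

/-- The vertices: the orbits of the rotation. -/
abbrev Vertex : Type := Quotient (Equiv.Perm.SameCycle.setoid B.rot)

/-- The vertex that carries a dart. -/
def vert (d : D) : B.Vertex := Quotient.mk (Equiv.Perm.SameCycle.setoid B.rot) d

/-- The successor of a dart along the border of the face on its left: cross the edge (or stay
in place, for a stem), then turn clockwise.  Following it along the outer face is the clockwise
exploration of the border of the outer face. -/
def next : Equiv.Perm D := B.rot * B.opp

/-- The two darts have the same face on their left.  A corner is represented by the dart
that follows it in clockwise order around its vertex, so this also says that the
two corners lie in the same face. -/
def SameFace (d d' : D) : Prop := B.next.SameCycle d d'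

/-- The dart is a stem. -/
def IsStem (d : D) : Prop := B.opp d = d

/-- An edge is directed from `u` to `v`. -/
def Arc (u v : B.Vertex) : Prop :=
  ∃ d, ¬ B.IsStem d ∧ B.out d ∧ B.vert d = u ∧ B.vert (B.opp d) = v

/-- From every vertex there is an oriented path to `r`. -/
def Accessible (r : B.Vertex) : Prop := ∀ u, Relation.ReflTransGen B.Arc u r

/-- There is no oriented cycle. -/
def Acyclic : Prop := ∀ u, ¬ Relation.TransGen B.Arc u u

/-- No incoming edge. -/
def IsSource (v : B.Vertex) : Prop := ¬ ∃ u, B.Arc u v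

/-- No outgoing edge. -/
def IsSink (v : B.Vertex) : Prop := ¬ ∃ u, B.Arc v u

/-- The number of edges. -/
noncomputable def numEdges : ℕ := Nat.card {d : D // ¬ B.IsStem d ∧ B.out d}

/-- A plane tree is a map with a single face. -/
def IsTree : Prop := ∀ d d', B.SameFace d d'

/-- `B'` arises from `B` by one local closure: an opening stem `b` is merged with the following
stem `c` along the clockwise border of the outer face, provided that `c` is a closing stem
(there are only edges in between), into a new edge directed from the vertex of `b` to that
of `c`.  The new dart `b` has the new outer face on its left; the new bounded face is on its
right. -/
def LocalClosure (B B' : BlossomingMap D) : Prop :=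
  ∃ b c : D, B.IsStem b ∧ B.out b ∧ B.IsStem c ∧ ¬ B.out c ∧
    (∃ k : ℕ, (B.next ^ k) b = c ∧ ∀ i, 0 < i → i < k → ¬ B.IsStem ((B.next ^ i) b)) ∧
    B'.rot = B.rot ∧ B'.opp = Equiv.swap b c * B.opp ∧ B'.out = B.out ∧ B'.SameFace B'.outer b

/-- `M` is the closure of `B`: it is reached by local closures, and no further one is possible. -/
def IsClosureOf (M B : BlossomingMap D) : Prop :=
  Relation.ReflTransGen LocalClosure B M ∧ ¬ ∃ M', LocalClosure M M'

/-- No vertex is incident twice to the same face: two corners (represented by the darts that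
follow them) at the same vertex and in the same face coincide. -/
def NonSeparable : Prop := ∀ d d', B.vert d = B.vert d' → B.SameFace d d' → d = d'

/-- `M`, rooted at the corner preceding the dart `root` in clockwise order (so that `root`
is on the root edge), is a plane bipolar orientation: a non-separable map without stems with
at least two edges, whose root corner is in the outer face, with an acyclic orientation that has a single
source and a single sink, where the sink is the root vertex and the source is the other end of
the root edge. -/
structure IsPlaneBipolar (M : BlossomingMap D) (root : D) : Prop where
  no_stem : ∀ d, ¬ M.IsStem d
  root_outer : M.SameFace M.outer root
  nonSeparable : M.NonSeparable
  two_le_numEdges : 2 ≤ M.numEdges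
  acyclic : M.Acyclic
  source_iff : ∀ v, M.IsSource v ↔ v = M.vert (M.opp root)
  sink_iff : ∀ v, M.IsSink v ↔ v = M.vert root

/-- `T` is the blossoming tree obtained by opening `M`, both rooted at the corner
preceding the dart `root`: the blossoming tree, endowed with an orientation accessible from the
root vertex, whose closure is `M`. -/
structure IsOpeningOf (T M : BlossomingMap D) (root : D) : Prop where
  isTree : T.IsTree
  accessible : T.Accessible (T.vert root)
  closure : M.IsClosureOf T

/-- `T`, rooted at the corner preceding `root`, is the opening of a plane bipolar orientation. -/
def IsBipolarTree (T : BlossomingMap D) (root : D) : Prop :=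
  ∃ M : BlossomingMap D, M.IsPlaneBipolar root ∧ T.IsOpeningOf M root

end BlossomingMap

/-- The four letters of contour words of rooted blossoming trees. -/
inductive Letter : Type
  /-- `e`: first exploration of an edge -/
  | e
  /-- `ē`: second exploration of an edge -/
  | ebar
  /-- `b`: an opening stem -/
  | b
  /-- `b̄`: a closing stem -/
  | bbar

namespace BlossomingMap

variable {D : Type} [Fintype D] [DecidableEq D] (B : BlossomingMap D)

open Classical in
/-- The letter read at step `i` of the clockwise contour that starts at the root corner. -/
noncomputable def contourLetter (root : D) (i : ℕ) : Letter :=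
  if B.IsStem ((B.next ^ i) root) then
    if B.out ((B.next ^ i) root) then Letter.b else Letter.bbar
  else if ∃ j < i, (B.next ^ j) root = B.opp ((B.next ^ i) root) then Letter.ebar
  else Letter.e

/-- The contour word of a rooted blossoming tree: the contour of a tree visits each dart once. -/
noncomputable def contourWord (root : D) : List Letter :=
  (List.range (Fintype.card D)).map (B.contourLetter root)

end BlossomingMap

namespace Letter

/-- Restriction to `{e, ē}`, with `e` as up-step and `ē` as down-step. -/
def edgeStep : Letter → Option DyckStep
  | e => some DyckStep.U
  | ebar => some DyckStep.D
  | b => none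
  | bbar => none

/-- Restriction to `{b, b̄}`, with `b` as up-step and `b̄` as down-step. -/
def stemStep : Letter → Option DyckStep
  | e => none
  | ebar => none
  | b => some DyckStep.U
  | bbar => some DyckStep.D

end Letter

/-! A tree has one edge fewer than vertices, so accessibility forces exactly one outgoing edge at
each non-root vertex, the edge to its parent. The contour letter of a dart is then read off from two
bits, stem or edge and `out` or not: `e` runs against the orientation of its edge, `ebar` along it.

Necessity. The edges of the tree match each `ebar` with an earlier `e`. The closure matches each
`bbar` with an earlier `b`, since the border of the outer face keeps the contour order as long as
the root stays on it (`IsTree.isPartialClosure`). If (4) fails, some factor `b e ... e bbar` occurs;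
its stems are consecutive, hence merged, and the new edge completes a directed cycle with tree
edges. If (5) fails, some factor `e b ... b ebar` occurs; it is a leaf that carries only opening
stems, hence a source other than the end of the root edge.

Sufficiency. The two Dyck words are noncrossing involutions `me` and `mb` of the positions, with
complementary fixed points. For `rot = jump me` and `opp = me * mb`, the face permutation is `jump
mb`. So vertices are the levels of `me` and faces the levels of `mb`, and Euler's relation holds
because a noncrossing involution has one level more than arcs. Keeping only the arcs of `mb` that
end before `k` gives the successive partial closures of the tree. Conditions (4) and (5) enter
through a descent: an edge opened and closed in a factor contains a `bbar`, and between this `bbar`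
and its match there is an earlier `ebar`. Applied to a first `ebar`, it gives `exists_first_ebar`,
which yields acyclicity and the source and sink conditions, and `not_balanced`, which yields
non-separability. -/

theorem Equiv.Perm.SameCycle.of_forall_apply {D : Type} [Finite D] {f g : Equiv.Perm D}
    (h : ∀ x, f.SameCycle x (g x)) {x y : D} (hxy : g.SameCycle x y) : f.SameCycle x y := by
  obtain ⟨i, -, rfl⟩ := hxy.exists_pow_eq'
  clear hxy
  induction i with
  | zero => exact Equiv.Perm.SameCycle.refl _ _
  | succ i ih =>
    rw [pow_succ', Equiv.Perm.mul_apply]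
    exact ih.trans (h _)

namespace BlossomingMap

variable {D : Type} [Fintype D] [DecidableEq D] {B B' T M : BlossomingMap D} {root b c d : D}

/-! ### Darts, vertices and arcs -/

theorem vert_eq_iff {x y : D} : B.vert x = B.vert y ↔ B.rot.SameCycle x y := Quotient.eq

theorem vert_rot (x : D) : B.vert (B.rot x) = B.vert x :=
  vert_eq_iff.2 (Equiv.Perm.sameCycle_apply_left.2 (Equiv.Perm.SameCycle.refl _ _))

theorem next_apply (x : D) : B.next x = B.rot (B.opp x) := rfl

theorem vert_next (x : D) : B.vert (B.next x) = B.vert (B.opp x) := vert_rot _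

theorem not_isStem_opp {x : D} (h : ¬ B.IsStem x) : ¬ B.IsStem (B.opp x) := fun h' =>
  h (B.opp.injective h')

theorem out_opp_iff {x : D} (h : ¬ B.IsStem x) : B.out (B.opp x) ↔ ¬ B.out x := B.out_opp x h

theorem arc_of_out {x : D} (h : ¬ B.IsStem x) (ho : B.out x) :
    B.Arc (B.vert x) (B.vert (B.opp x)) := ⟨x, h, ho, rfl, rfl⟩

theorem arc_of_not_out {x : D} (h : ¬ B.IsStem x) (ho : ¬ B.out x) :
    B.Arc (B.vert (B.opp x)) (B.vert x) := by
  have := arc_of_out (not_isStem_opp h) ((out_opp_iff h).2 ho)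
  rwa [B.opp_opp] at this

/-! ### Trees with an orientation that is accessible from the root -/

theorem IsTree.card_vertex (hT : T.IsTree) : Nat.card T.Vertex = T.numEdges + 1 := by
  have h1 : Nat.card (Quotient (Equiv.Perm.SameCycle.setoid (T.rot * T.opp))) = 1 := by
    rw [Nat.card_eq_one_iff_unique]
    refine ⟨⟨fun x y => ?_⟩, ⟨Quotient.mk _ T.outer⟩⟩
    induction x using Quotient.inductionOn
    induction y using Quotient.inductionOn
    exact Quotient.sound (hT _ _)
  have h2 := T.euler
  rw [h1] at h2
  have h3 : Nat.card {d : D // T.opp d ≠ d ∧ T.out d} = T.numEdges := rfl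
  have h4 : Nat.card (Quotient (Equiv.Perm.SameCycle.setoid T.rot)) = Nat.card T.Vertex := rfl
  omega

/-- Choosing an outgoing dart at each non-root vertex is injective, and there are as many non-root
vertices as edges. The choice is therefore a bijection, so no other outgoing dart exists. -/
theorem IsTree.vert_ne_and_out_unique (hT : T.IsTree) (hacc : T.Accessible (T.vert root)) :
    (∀ x, ¬ T.IsStem x → T.out x → T.vert x ≠ T.vert root) ∧
    ∀ x y, ¬ T.IsStem x → T.out x → ¬ T.IsStem y → T.out y → T.vert x = T.vert y → x = y := by
  have hex : ∀ v : {v : T.Vertex // v ≠ T.vert root},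
      ∃ d : {d : D // ¬ T.IsStem d ∧ T.out d}, T.vert d.1 = v.1 := by
    rintro ⟨v, hv⟩
    rcases (hacc v).cases_head with h | ⟨u, ⟨d, h1, h2, h3, -⟩, -⟩
    · exact absurd h hv
    · exact ⟨⟨d, h1, h2⟩, h3⟩
  choose f hf using hex
  have hinj : Function.Injective f := fun v v' h => Subtype.ext (by rw [← hf v, ← hf v', h])
  have hcard : Nat.card {d : D // ¬ T.IsStem d ∧ T.out d} ≤
      Nat.card {v : T.Vertex // v ≠ T.vert root} := by
    have h1 : Nat.card {v : T.Vertex // v ≠ T.vert root} = Nat.card T.Vertex - 1 := by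
      classical
      have := Fintype.ofFinite T.Vertex
      rw [Nat.card_eq_fintype_card, Nat.card_eq_fintype_card, Fintype.card_subtype_compl]
      simp
    rw [h1, hT.card_vertex]
    exact le_rfl
  have hsurj := (hinj.bijective_of_nat_card_le hcard).2
  refine ⟨fun x hx ho => ?_, fun x y hx hox hy hoy hxy => ?_⟩
  · obtain ⟨v, hv⟩ := hsurj ⟨x, hx, ho⟩
    have := hf v
    rw [hv] at this
    rw [this]; exact v.2
  · obtain ⟨v, hv⟩ := hsurj ⟨x, hx, hox⟩
    obtain ⟨v', hv'⟩ := hsurj ⟨y, hy, hoy⟩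
    have h := hf v
    have h' := hf v'
    rw [hv] at h
    rw [hv'] at h'
    have : v = v' := Subtype.ext (by rw [← h, ← h', hxy])
    subst this
    exact congrArg Subtype.val (hv.symm.trans hv')

theorem IsTree.isCycleOn (hT : T.IsTree) : T.next.IsCycleOn ((Finset.univ : Finset D) : Set D) :=
  ⟨by simp, fun x _ y _ => hT x y⟩

theorem IsTree.exists_pow_eq (hT : T.IsTree) (root d : D) :
    ∃ i < Fintype.card D, (T.next ^ i) root = d :=
  hT.isCycleOn.exists_pow_eq (Finset.mem_univ root) (Finset.mem_univ d)

theorem IsTree.pow_inj (hT : T.IsTree) {i j : ℕ} (hi : i < Fintype.card D)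
    (hj : j < Fintype.card D) (h : (T.next ^ i) root = (T.next ^ j) root) : i = j := by
  have := (hT.isCycleOn.pow_apply_eq_pow_apply (Finset.mem_univ root)).1 h
  exact Nat.ModEq.eq_of_lt_of_lt this hi hj

/-- The step of the contour starting at `root` that visits a dart. -/
noncomputable def pos (T : BlossomingMap D) (root d : D) : ℕ :=
  sInf {i | (T.next ^ i) root = d}

theorem IsTree.pow_pos (hT : T.IsTree) (root d : D) : (T.next ^ T.pos root d) root = d :=
  Nat.sInf_mem (s := {i | (T.next ^ i) root = d})
    ⟨_, (hT.exists_pow_eq root d).choose_spec.2⟩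

theorem IsTree.pos_lt (hT : T.IsTree) (root d : D) : T.pos root d < Fintype.card D := by
  obtain ⟨i, hi, h⟩ := hT.exists_pow_eq root d
  exact lt_of_le_of_lt (Nat.sInf_le h) hi

theorem IsTree.pos_pow (hT : T.IsTree) {i : ℕ} (hi : i < Fintype.card D) :
    T.pos root ((T.next ^ i) root) = i :=
  hT.pow_inj (hT.pos_lt _ _) hi (hT.pow_pos _ _)

theorem IsTree.pos_root (hT : T.IsTree) : T.pos root root = 0 :=
  hT.pos_pow (i := 0) (Fintype.card_pos_iff.2 ⟨root⟩)

theorem IsTree.pos_next (hT : T.IsTree) {x : D} (h : T.next x ≠ root) :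
    T.pos root x < T.pos root (T.next x) := by
  have h1 : (T.next ^ (T.pos root x + 1)) root = T.next x := by
    rw [pow_succ', Equiv.Perm.mul_apply, hT.pow_pos]
  rcases (Nat.succ_le_of_lt (hT.pos_lt root x)).lt_or_eq with h2 | h2
  · rw [← h1, hT.pos_pow h2]; exact Nat.lt_succ_self _
  · exfalso
    apply h
    rw [← h1, show T.pos root x + 1 = Fintype.card D from h2]
    exact (hT.isCycleOn.pow_apply_eq (Finset.mem_univ root)).2 dvd_rfl

/-- The contour starts outside the subtree that hangs from the edge of `d`, and can enter it only
through `T.opp d`. -/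
theorem IsTree.pos_opp_lt (hT : T.IsTree) (hacc : T.Accessible (T.vert root)) {d : D}
    (hd : ¬ T.IsStem d) (ho : T.out d) : T.pos root (T.opp d) < T.pos root d := by
  obtain ⟨hroot, huniq⟩ := hT.vert_ne_and_out_unique hacc
  -- The subtree below `d`: the vertices with a directed path to the origin of `d`. Crossing any
  -- edge other than that of `d` does not leave it.
  set S : T.Vertex → Prop := fun v => Relation.ReflTransGen T.Arc v (T.vert d) with hS
  have hstep : ∀ x, ¬ T.IsStem x → T.out x → x ≠ d → S (T.vert x) → S (T.vert (T.opp x)) := by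
    intro x hx hox hxd h
    rcases h.cases_head with h | ⟨u, ⟨y, h1, h2, h3, h4⟩, h5⟩
    · exact absurd (huniq x d hx hox hd ho h) hxd
    · obtain rfl := huniq y x h1 h2 hx hox h3
      rwa [← h4] at h5
  have hnroot : ¬ S (T.vert root) := by
    intro h
    rcases h.cases_head with h | ⟨u, ⟨y, h1, h2, h3, h4⟩, h5⟩
    · exact hroot d hd ho h.symm
    · exact hroot y h1 h2 h3
  have hnopp : ¬ S (T.vert (T.opp d)) := by
    intro h
    have hclosed : ∀ u v, T.Arc u v → S u → S v := by
      rintro u v ⟨y, h1, h2, rfl, rfl⟩ hu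
      by_cases hyd : y = d
      · rwa [hyd]
      · exact hstep y h1 h2 hyd hu
    have : ∀ v, Relation.ReflTransGen T.Arc (T.vert d) v → S v := by
      intro v hv
      induction hv with
      | refl => exact Relation.ReflTransGen.refl
      | tail _ h2 ih => exact hclosed _ _ h2 ih
    exact hnroot (this _ (hacc _))
  have hopp : ∀ x, x ≠ d → S (T.vert x) → S (T.vert (T.opp x)) := by
    intro x hxd h
    by_cases hx : T.IsStem x
    · rwa [hx]
    · by_cases hox : T.out x
      · exact hstep x hx hox hxd h
      · exact Relation.ReflTransGen.head (arc_of_not_out hx hox) h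
  have hwalk : ∀ i ≤ T.pos root (T.opp d), ¬ S (T.vert ((T.next ^ i) root)) := by
    intro i
    induction i with
    | zero => exact fun _ => hnroot
    | succ i ih =>
      intro hi h
      have hi' := ih (Nat.le_of_succ_le hi)
      rw [pow_succ', Equiv.Perm.mul_apply, vert_next] at h
      have hne : T.opp ((T.next ^ i) root) ≠ d := by
        intro h'
        have h2 : (T.next ^ i) root = T.opp d := by rw [← h', T.opp_opp]
        have h3 := hT.pos_lt root (T.opp d)
        have : T.pos root ((T.next ^ i) root) = i := hT.pos_pow (by omega)
        rw [h2] at this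
        omega
      have := hopp _ hne h
      rw [T.opp_opp] at this
      exact hi' this
  by_contra hlt
  apply hwalk (T.pos root d) (not_lt.1 hlt)
  rw [hT.pow_pos]

theorem contourLetter_of_isStem_out {i : ℕ} (h : T.IsStem ((T.next ^ i) root))
    (ho : T.out ((T.next ^ i) root)) : T.contourLetter root i = Letter.b := by
  simp [contourLetter, h, ho]

theorem contourLetter_of_isStem_not_out {i : ℕ} (h : T.IsStem ((T.next ^ i) root))
    (ho : ¬ T.out ((T.next ^ i) root)) : T.contourLetter root i = Letter.bbar := by
  simp [contourLetter, h, ho]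

theorem IsTree.contourLetter_of_out (hT : T.IsTree) (hacc : T.Accessible (T.vert root)) {i : ℕ}
    (hi : i < Fintype.card D) (h : ¬ T.IsStem ((T.next ^ i) root))
    (ho : T.out ((T.next ^ i) root)) : T.contourLetter root i = Letter.ebar := by
  have h1 := hT.pos_opp_lt hacc h ho
  rw [hT.pos_pow hi] at h1
  rw [contourLetter, if_neg h, if_pos ⟨_, h1, hT.pow_pos _ _⟩]

theorem IsTree.contourLetter_of_not_out (hT : T.IsTree) (hacc : T.Accessible (T.vert root)) {i : ℕ}
    (hi : i < Fintype.card D) (h : ¬ T.IsStem ((T.next ^ i) root))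
    (ho : ¬ T.out ((T.next ^ i) root)) : T.contourLetter root i = Letter.e := by
  have h1 := hT.pos_opp_lt hacc (not_isStem_opp h) ((out_opp_iff h).2 ho)
  rw [T.opp_opp, hT.pos_pow hi] at h1
  rw [contourLetter, if_neg h, if_neg]
  rintro ⟨j, hj, h2⟩
  rw [← h2, hT.pos_pow (hj.trans hi)] at h1
  omega

/-- By `pos_opp_lt`, an edge is explored for the second time exactly along its outgoing dart, so
"first" and "second" no longer refer to the history of the contour. -/
theorem IsTree.contourLetter_iff (hT : T.IsTree) (hacc : T.Accessible (T.vert root)) {i : ℕ}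
    (hi : i < Fintype.card D) :
    (T.contourLetter root i = Letter.b ↔
      T.IsStem ((T.next ^ i) root) ∧ T.out ((T.next ^ i) root)) ∧
    (T.contourLetter root i = Letter.bbar ↔
      T.IsStem ((T.next ^ i) root) ∧ ¬ T.out ((T.next ^ i) root)) ∧
    (T.contourLetter root i = Letter.ebar ↔
      ¬ T.IsStem ((T.next ^ i) root) ∧ T.out ((T.next ^ i) root)) ∧
    (T.contourLetter root i = Letter.e ↔
      ¬ T.IsStem ((T.next ^ i) root) ∧ ¬ T.out ((T.next ^ i) root)) := by
  by_cases h : T.IsStem ((T.next ^ i) root) <;> by_cases ho : T.out ((T.next ^ i) root)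
  · rw [contourLetter_of_isStem_out h ho]; simp [h, ho]
  · rw [contourLetter_of_isStem_not_out h ho]; simp [h, ho]
  · rw [hT.contourLetter_of_out hacc hi h ho]; simp [h, ho]
  · rw [hT.contourLetter_of_not_out hacc hi h ho]; simp [h, ho]

theorem contourWord_getElem? {i : ℕ} {l : Letter} :
    (T.contourWord root)[i]? = some l ↔ i < Fintype.card D ∧ T.contourLetter root i = l := by
  simp only [contourWord, List.getElem?_map, Option.map_eq_some_iff]
  constructor
  · rintro ⟨a, h1, h2⟩
    rw [List.getElem?_eq_some_iff] at h1
    obtain ⟨h, h1⟩ := h1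
    simp at h h1
    subst h1
    exact ⟨h, h2⟩
  · rintro ⟨h, h2⟩
    exact ⟨i, by simp [h], h2⟩

/-! ### Local closures -/

theorem next_eq_of_ne (hb : B.IsStem b) (hc : B.IsStem c) (hrot : B'.rot = B.rot)
    (hopp : B'.opp = Equiv.swap b c * B.opp) {x : D} (hxb : x ≠ b) (hxc : x ≠ c) :
    B'.next x = B.next x := by
  rw [next_apply, next_apply, hrot, hopp, Equiv.Perm.mul_apply, Equiv.swap_apply_of_ne_of_ne]
  · rintro h; exact hxb (B.opp.injective (h.trans hb.symm))
  · rintro h; exact hxc (B.opp.injective (h.trans hc.symm))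

theorem next_eq_left (hb : B.IsStem b) (hc : B.IsStem c) (hrot : B'.rot = B.rot)
    (hopp : B'.opp = Equiv.swap b c * B.opp) : B'.next b = B.next c := by
  rw [next_apply, next_apply, hrot, hopp, Equiv.Perm.mul_apply, hb, hc, Equiv.swap_apply_left]

theorem next_eq_right (hb : B.IsStem b) (hc : B.IsStem c) (hrot : B'.rot = B.rot)
    (hopp : B'.opp = Equiv.swap b c * B.opp) : B'.next c = B.next b := by
  rw [next_apply, next_apply, hrot, hopp, Equiv.Perm.mul_apply, hb, hc, Equiv.swap_apply_right]

theorem opp_eq_of_closure (hb : B.IsStem b) (hc : B.IsStem c)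
    (hopp : B'.opp = Equiv.swap b c * B.opp) {x : D} (hxb : x ≠ b) (hxc : x ≠ c) :
    B'.opp x = B.opp x := by
  rw [hopp, Equiv.Perm.mul_apply, Equiv.swap_apply_of_ne_of_ne]
  · rintro h; exact hxb (B.opp.injective (h.trans hb.symm))
  · rintro h; exact hxc (B.opp.injective (h.trans hc.symm))

theorem sameFace_next (x : D) : B.SameFace x (B.next x) :=
  Equiv.Perm.sameCycle_apply_right.2 (Equiv.Perm.SameCycle.refl _ _)

theorem IsStem.sameFace_outer {x : D} (h : B.IsStem x) : B.SameFace B.outer x := B.stem_outer x h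

/-- Merging exchanges the successors of `b` and `c`, which already share a face; this can split
faces but not join them. -/
theorem SameFace.of_closure (hb : B.IsStem b) (hc : B.IsStem c) (hrot : B'.rot = B.rot)
    (hopp : B'.opp = Equiv.swap b c * B.opp) {x y : D} (h : B'.SameFace x y) :
    B.SameFace x y := by
  have hbc : B.SameFace b c := hb.sameFace_outer.symm.trans hc.sameFace_outer
  refine Equiv.Perm.SameCycle.of_forall_apply (fun x => ?_) h
  by_cases hxb : x = b
  · subst hxb
    rw [next_eq_left hb hc hrot hopp]
    exact hbc.trans (sameFace_next c)
  · by_cases hxc : x = c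
    · subst hxc
      rw [next_eq_right hb hc hrot hopp]
      exact hbc.symm.trans (sameFace_next b)
    · rw [next_eq_of_ne hb hc hrot hopp hxb hxc]
      exact sameFace_next x

/-- `c` is the first stem after `b` along the border of the face of `b`. -/
def Consecutive (B : BlossomingMap D) (b c : D) : Prop :=
  ∃ k : ℕ, (B.next ^ k) b = c ∧ ∀ i, 0 < i → i < k → ¬ B.IsStem ((B.next ^ i) b)

/-- The darts between two consecutive stems `b` and `c` go to a bounded face when
`b` and `c` are merged. -/
theorem not_sameFace_of_closure (hb : B.IsStem b) (hc : B.IsStem c) (hbc : b ≠ c)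
    (hrot : B'.rot = B.rot) (hopp : B'.opp = Equiv.swap b c * B.opp) {k : ℕ}
    (hk : (B.next ^ k) b = c) (hks : ∀ i, 0 < i → i < k → ¬ B.IsStem ((B.next ^ i) b)) {i : ℕ}
    (hi : 0 < i) (hik : i ≤ k) : ¬ B'.SameFace b ((B.next ^ i) b) := by
  have hk0 : 0 < k := hi.trans_le hik
  have hnb : ∀ j, 0 < j → j ≤ k → (B.next ^ j) b ≠ b := by
    intro j hj hjk h
    rcases hjk.lt_or_eq with h' | rfl
    · exact hks j hj h' (by rwa [h])
    · exact hbc (h.symm.trans hk)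
  have hstep : ∀ x, (∃ j, 0 < j ∧ j ≤ k ∧ (B.next ^ j) b = x) →
      ∃ j, 0 < j ∧ j ≤ k ∧ (B.next ^ j) b = B'.next x := by
    rintro x ⟨j, h1, h2, rfl⟩
    rcases h2.lt_or_eq with h2 | rfl
    · refine ⟨j + 1, by omega, h2, ?_⟩
      rw [pow_succ', Equiv.Perm.mul_apply, next_eq_of_ne hb hc hrot hopp (hnb j h1 h2.le)]
      intro h
      exact hks j h1 h2 (by rwa [h])
    · exact ⟨1, one_pos, hk0, by rw [hk, next_eq_right hb hc hrot hopp, pow_one]⟩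
  intro h
  obtain ⟨m, -, hm⟩ := h.symm.exists_pow_eq'
  have : ∀ m, ∃ j, 0 < j ∧ j ≤ k ∧ (B.next ^ j) b = (B'.next ^ m) ((B.next ^ i) b) := by
    intro m
    induction m with
    | zero => exact ⟨i, hi, hik, rfl⟩
    | succ m ih =>
      rw [pow_succ', Equiv.Perm.mul_apply]
      exact hstep _ ih
  obtain ⟨j, h1, h2, h3⟩ := this m
  exact hnb j h1 h2 (h3.trans hm)

/-- What is known about a map with the root in its outer face that is reached by local closures
from a tree. -/
structure IsPartialClosure (T B : BlossomingMap D) (root : D) : Prop where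
  rot_eq : B.rot = T.rot
  out_eq : B.out = T.out
  opp_eq : ∀ x, ¬ T.IsStem x → B.opp x = T.opp x
  isStem_opp : ∀ x, T.IsStem x → T.IsStem (B.opp x)
  pos_lt_opp : ∀ x, T.IsStem x → ¬ B.IsStem x → B.out x → T.pos root x < T.pos root (B.opp x)
  pos_lt_next : ∀ x, B.SameFace B.outer x → B.next x ≠ root → T.pos root x < T.pos root (B.next x)

theorem IsPartialClosure.not_isStem (h : IsPartialClosure T B root) {x : D} (hx : B.IsStem x) :
    T.IsStem x := by
  by_contra h'
  exact h' ((h.opp_eq x h').symm.trans hx)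

/-- Induction on the local closures. Faces only get finer, so a root in the final outer face was in
every earlier one. It is then not among the darts cut off between `b` and `c`, and positions
increase all the way from `b` to `c`. The shortcut from `b` to the successor of `c` preserves this
monotonicity on the new border. -/
theorem IsTree.isPartialClosure (hT : T.IsTree)
    (hTB : Relation.ReflTransGen LocalClosure T B) (hroot : B.SameFace B.outer root) :
    IsPartialClosure T B root := by
  induction hTB with
  | refl => exact ⟨rfl, rfl, fun _ _ => rfl, fun x h => not_not.1 fun h' => not_isStem_opp (B := T) (x := T.opp x) h' (by rwa [T.opp_opp]), fun x h h' => absurd h h',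
      fun x _ h => hT.pos_next h⟩
  | @tail B B' hTB hBB' ih =>
    obtain ⟨b, c, hb, hob, hc, hoc, ⟨k, hk, hks⟩, hrot, hopp, hout, hface⟩ := hBB'
    have hbc : b ≠ c := fun h => hoc (h ▸ hob)
    have hmono : ∀ {x y}, B'.SameFace x y → B.SameFace x y := fun h =>
      h.of_closure hb hc hrot hopp
    have hbroot : B'.SameFace b root := hface.symm.trans hroot
    have H := ih (hb.sameFace_outer.trans (hmono hbroot))
    have hTb := H.not_isStem hb
    have hTc := H.not_isStem hc
    have hnroot : ∀ i, 0 < i → i ≤ k → (B.next ^ i) b ≠ root := by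
      intro i h1 h2 h
      exact not_sameFace_of_closure hb hc hbc hrot hopp hk hks h1 h2 (h ▸ hbroot)
    have hpos : ∀ i ≤ k, 0 < i → T.pos root b < T.pos root ((B.next ^ i) b) := by
      intro i
      induction i with
      | zero => intro _ h; exact absurd h (lt_irrefl _)
      | succ i ihi =>
        intro hik _
        have h1 := hnroot (i + 1) (by omega) hik
        rw [pow_succ', Equiv.Perm.mul_apply] at h1 ⊢
        have h2 := H.pos_lt_next ((B.next ^ i) b)
          (hb.sameFace_outer.trans ⟨i, by simp⟩) h1
        rcases Nat.eq_zero_or_pos i with rfl | h3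
        · exact h2
        · exact (ihi (by omega) h3).trans h2
    have hk0 : 0 < k := Nat.pos_of_ne_zero (by rintro rfl; exact hbc hk)
    have hposbc : T.pos root b < T.pos root c := hk ▸ hpos k le_rfl hk0
    have hopp' : ∀ x, x ≠ b → x ≠ c → B'.opp x = B.opp x := fun x =>
      opp_eq_of_closure hb hc hopp
    have hoppb : B'.opp b = c := by
      rw [hopp, Equiv.Perm.mul_apply, hb, Equiv.swap_apply_left]
    have hoppc : B'.opp c = b := by
      rw [hopp, Equiv.Perm.mul_apply, hc, Equiv.swap_apply_right]
    refine ⟨hrot.trans H.rot_eq, hout.trans H.out_eq, fun x hx => ?_, fun x hx => ?_,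
      fun x hx hx' ho => ?_, fun x hx hx' => ?_⟩
    · rw [hopp' x (fun h => hx (h ▸ hTb)) (fun h => hx (h ▸ hTc)), H.opp_eq x hx]
    · by_cases hxb : x = b
      · rw [hxb, hoppb]; exact hTc
      by_cases hxc : x = c
      · rw [hxc, hoppc]; exact hTb
      rw [hopp' x hxb hxc]; exact H.isStem_opp x hx
    · by_cases hxb : x = b
      · rw [hxb, hoppb]; exact hposbc
      by_cases hxc : x = c
      · rw [hxc, hout] at ho; exact absurd ho hoc
      rw [hopp' x hxb hxc]
      refine H.pos_lt_opp x hx (fun h => hx' ?_) (hout ▸ ho)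
      exact (hopp' x hxb hxc).trans h
    · have hbx : B'.SameFace b x := hface.symm.trans hx
      by_cases hxb : x = b
      · subst hxb
        rw [next_eq_left hb hc hrot hopp] at hx' ⊢
        exact hposbc.trans (H.pos_lt_next c hc.sameFace_outer hx')
      by_cases hxc : x = c
      · subst hxc
        exact absurd (hk.symm ▸ hbx) (not_sameFace_of_closure hb hc hbc hrot hopp hk hks hk0 le_rfl)
      rw [next_eq_of_ne hb hc hrot hopp hxb hxc] at hx' ⊢
      exact H.pos_lt_next x (hb.sameFace_outer.trans (hmono hbx)) hx'

theorem Consecutive.right_unique (h : B.Consecutive b c) (h' : B.Consecutive b d)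
    (hc : B.IsStem c) (hd : B.IsStem d) (hbc : b ≠ c) (hbd : b ≠ d) : c = d := by
  obtain ⟨k, hk, hks⟩ := h
  obtain ⟨l, hl, hls⟩ := h'
  have hk0 : 0 < k := Nat.pos_of_ne_zero (by rintro rfl; exact hbc hk)
  have hl0 : 0 < l := Nat.pos_of_ne_zero (by rintro rfl; exact hbd hl)
  rcases lt_trichotomy k l with h | rfl | h
  · exact absurd (hk ▸ hc) (hls k hk0 h)
  · exact hk.symm.trans hl
  · exact absurd (hl ▸ hd) (hks l hl0 h)

theorem Consecutive.left_unique (h : B.Consecutive b d) (h' : B.Consecutive c d)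
    (hb : B.IsStem b) (hc : B.IsStem c) (hbd : b ≠ d) (hcd : c ≠ d) : b = c := by
  have key : ∀ {b c : D}, B.IsStem b → c ≠ d → ∀ k l, (B.next ^ k) b = d → (B.next ^ l) c = d →
      (∀ i, 0 < i → i < l → ¬ B.IsStem ((B.next ^ i) c)) → 0 < k → ¬ k < l := by
    intro b c hb hcd k l hk hl hls hk0 hkl
    have h1 : (B.next ^ k) ((B.next ^ (l - k)) c) = (B.next ^ k) b := by
      rw [← Equiv.Perm.mul_apply, ← pow_add, Nat.add_sub_cancel' hkl.le, hl, hk]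
    exact hls (l - k) (by omega) (by omega) ((B.next ^ k).injective h1 ▸ hb)
  obtain ⟨k, hk, hks⟩ := h
  obtain ⟨l, hl, hls⟩ := h'
  have hk0 : 0 < k := Nat.pos_of_ne_zero (by rintro rfl; exact hbd hk)
  have hl0 : 0 < l := Nat.pos_of_ne_zero (by rintro rfl; exact hcd hl)
  have h1 := key hb hcd k l hk hl hls hk0
  have h2 := key hc hbd l k hl hk hks hl0
  obtain rfl : k = l := by omega
  exact (B.next ^ k).injective (hk.trans hl.symm)

/-- Consecutive opening and closing stems are merged by the closure. -/
theorem opp_eq_of_consecutive (hTM : Relation.ReflTransGen LocalClosure T M)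
    (hM : ∀ x, ¬ M.IsStem x) (hb : T.IsStem b) (hob : T.out b) (hc : T.IsStem c)
    (hoc : ¬ T.out c) (h : T.Consecutive b c) : M.opp b = c := by
  have hbc : b ≠ c := fun h => hoc (h ▸ hob)
  have key : M.out = T.out ∧ (M.opp b = c ∨ (M.IsStem b ∧ M.IsStem c ∧ M.Consecutive b c)) := by
    clear hM
    induction hTM with
    | refl => exact ⟨rfl, Or.inr ⟨hb, hc, h⟩⟩
    | @tail B B' hTB hBB' ih =>
      obtain ⟨p, q, hp, hop, hq, hoq, hpq, hrot, hopp, hout, -⟩ := hBB'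
      obtain ⟨ho, ih⟩ := ih
      refine ⟨hout.trans ho, ?_⟩
      have hpq' : p ≠ q := fun h => hoq (h ▸ hop)
      have hbq : b ≠ q := by rintro rfl; rw [ho] at hoq; exact hoq hob
      have hcp : c ≠ p := by rintro rfl; rw [ho] at hop; exact hoc hop
      rcases ih with ih | ⟨hb, hc, hcons⟩
      · left
        rw [opp_eq_of_closure hp hq hopp _ hbq, ih]
        rintro rfl
        exact hbc (hp.symm.trans ih)
      · by_cases hbp : b = p
        · subst hbp
          left
          rw [hopp, Equiv.Perm.mul_apply, hb, Equiv.swap_apply_left]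
          exact (Consecutive.right_unique hcons hpq hc hq hbc hpq').symm
        · have hcq : c ≠ q := by
            rintro rfl
            exact hbp (Consecutive.left_unique hcons hpq hb hp hbc hpq')
          right
          refine ⟨(opp_eq_of_closure hp hq hopp hbp hbq).trans hb,
            (opp_eq_of_closure hp hq hopp hcp hcq).trans hc, ?_⟩
          obtain ⟨k, hk, hks⟩ := hcons
          -- A merger of two other stems leaves the walk from `b` to `c` unchanged, as this walk
          -- meets no stem in between.
          have hpath : ∀ i ≤ k, (B'.next ^ i) b = (B.next ^ i) b := by
            intro i
            induction i with
            | zero => exact fun _ => rfl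
            | succ i ih =>
              intro hi
              rw [pow_succ', pow_succ', Equiv.Perm.mul_apply, Equiv.Perm.mul_apply,
                ih (Nat.le_of_succ_le hi)]
              rcases Nat.eq_zero_or_pos i with rfl | h3
              · exact next_eq_of_ne hp hq hrot hopp hbp hbq
              · have := hks i h3 hi
                exact next_eq_of_ne hp hq hrot hopp (fun h => this (h ▸ hp))
                  (fun h => this (h ▸ hq))
          refine ⟨k, (hpath k le_rfl).trans hk, fun i h0 hi h => ?_⟩
          rw [hpath i hi.le] at h
          have := hks i h0 hi
          exact this ((opp_eq_of_closure hp hq hopp (fun h => this (by rw [h]; exact hp))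
            (fun h => this (by rw [h]; exact hq))).symm.trans h)
  exact key.2.resolve_right fun h => hM b h.1

end BlossomingMap

/-! ### Dyck words from matchings -/

theorem List.exists_take_filterMap {α β : Type} (f : α → Option β) (l : List α) (k : ℕ) :
    ∃ i ≤ l.length, (l.filterMap f).take k = (l.take i).filterMap f := by
  induction l generalizing k with
  | nil => exact ⟨0, le_rfl, by simp⟩
  | cons a l ih =>
    rcases h : f a with _ | b
    · obtain ⟨i, hi, h'⟩ := ih k
      exact ⟨i + 1, by simpa using hi, by simp [h, h']⟩
    · rcases k with _ | k
      · exact ⟨0, by simp, by simp⟩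
      · obtain ⟨i, hi, h'⟩ := ih k
        exact ⟨i + 1, by simpa using hi, by simp [h, h']⟩

theorem List.count_filterMap_map_range {α : Type} (s : α → Option DyckStep) (l : ℕ → α) (k : ℕ)
    (x : DyckStep) : (((List.range k).map l).filterMap s).count x =
      ((Finset.range k).filter fun i => s (l i) = some x).card := by
  induction k with
  | zero => simp
  | succ k ih =>
    rw [List.range_succ, List.map_append, List.filterMap_append, List.count_append, ih,
      Finset.range_add_one, Finset.filter_insert]
    rcases h : s (l k) with _ | y
    · simp [h]
    · by_cases hxy : y = x
      · subst hxy
        rw [if_pos rfl, Finset.card_insert_of_notMem (by simp)]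
        simp [h]
      · rw [if_neg (by simpa using hxy)]
        simp [h, hxy]

/-- A word is a Dyck word if its down-steps are matched with earlier up-steps. -/
theorem exists_dyckWord_of_matching {α : Type} (n : ℕ) (s : α → Option DyckStep) (l : ℕ → α)
    (μ : ℕ → ℕ) (hD : ∀ i < n, s (l i) = some DyckStep.D →
      μ i < i ∧ s (l (μ i)) = some DyckStep.U)
    (hU : ∀ i < n, s (l i) = some DyckStep.U → μ i < n ∧ s (l (μ i)) = some DyckStep.D)
    (hμ : ∀ i < n, s (l i) ≠ none → μ (μ i) = i) :
    ∃ p : DyckWord, p.toList = ((List.range n).map l).filterMap s := by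
  -- Partners of down-steps come earlier, so `μ` injects the down-steps of each prefix into its
  -- up-steps; on the whole word it also injects in the other direction.
  have hle : ∀ k ≤ n, (((List.range k).map l).filterMap s).count DyckStep.D ≤
      (((List.range k).map l).filterMap s).count DyckStep.U := by
    intro k hk
    rw [List.count_filterMap_map_range, List.count_filterMap_map_range]
    refine Finset.card_le_card_of_injOn μ (fun i hi => ?_) (fun i hi j hj h => ?_)
    · simp only [Finset.coe_filter, Finset.mem_range, Set.mem_ofPred_eq] at hi ⊢
      have := hD i (by omega) hi.2
      exact ⟨by omega, this.2⟩
    · simp only [Finset.coe_filter, Finset.mem_range, Set.mem_ofPred_eq] at hi hj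
      rw [← hμ i (by omega) (by simp [hi.2]), h, hμ j (by omega) (by simp [hj.2])]
  have hge : (((List.range n).map l).filterMap s).count DyckStep.U ≤
      (((List.range n).map l).filterMap s).count DyckStep.D := by
    rw [List.count_filterMap_map_range, List.count_filterMap_map_range]
    refine Finset.card_le_card_of_injOn μ (fun i hi => ?_) (fun i hi j hj h => ?_)
    · simp only [Finset.coe_filter, Finset.mem_range, Set.mem_ofPred_eq] at hi ⊢
      exact hU i (by omega) hi.2
    · simp only [Finset.coe_filter, Finset.mem_range, Set.mem_ofPred_eq] at hi hj
      rw [← hμ i (by omega) (by simp [hi.2]), h, hμ j (by omega) (by simp [hj.2])]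
  refine ⟨⟨_, le_antisymm hge (hle n le_rfl), fun k => ?_⟩, rfl⟩
  obtain ⟨i, hi, h⟩ := List.exists_take_filterMap s ((List.range n).map l) k
  rw [h, ← List.map_take, List.take_range]
  exact hle _ (min_le_right _ _)

/-- Between two positions, there are two closest ones with the same properties. -/
theorem Nat.exists_closest_pair {p q : ℕ → Prop} {i j : ℕ} (hij : i < j) (hi : p i) (hj : q j) :
    ∃ i' j', i ≤ i' ∧ i' < j' ∧ j' ≤ j ∧ p i' ∧ q j' ∧ ∀ k, i' < k → k < j' → ¬ p k ∧ ¬ q k := by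
  induction hm : j - i using Nat.strong_induction_on generalizing i j with
  | _ m ih =>
    subst hm
    by_cases h : ∀ k, i < k → k < j → ¬ p k ∧ ¬ q k
    · exact ⟨i, j, le_rfl, hij, le_rfl, hi, hj, h⟩
    · push Not at h
      obtain ⟨k, h1, h2, h3⟩ := h
      by_cases hk : p k
      · obtain ⟨i', j', h4, h5, h6, h7⟩ := ih (j - k) (by omega) h2 hk hj rfl
        exact ⟨i', j', by omega, h5, h6, h7⟩
      · obtain ⟨i', j', h4, h5, h6, h7⟩ := ih (k - i) (by omega) h1 hi (h3 hk) rfl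
        exact ⟨i', j', h4, h5, by omega, h7⟩

/-! ### Necessity of the five conditions -/

namespace BlossomingMap

variable {D : Type} [Fintype D] [DecidableEq D] {T M : BlossomingMap D} {root : D}

theorem IsPartialClosure.vert_eq_iff (h : IsPartialClosure T M root) {x y : D} :
    M.vert x = M.vert y ↔ T.vert x = T.vert y := by
  rw [BlossomingMap.vert_eq_iff, BlossomingMap.vert_eq_iff, h.rot_eq]

theorem IsSource.out (hv : M.IsSource (M.vert root)) (h : ¬ M.IsStem root) : M.out root := by
  by_contra ho
  exact hv ⟨_, arc_of_not_out h ho⟩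

theorem IsSink.not_out (hv : M.IsSink (M.vert root)) (h : ¬ M.IsStem root) : ¬ M.out root :=
  fun ho => hv ⟨_, arc_of_out h ho⟩

theorem IsPlaneBipolar.not_out_root (hM : M.IsPlaneBipolar root) : ¬ M.out root :=
  IsSink.not_out ((hM.sink_iff _).2 rfl) (hM.no_stem _)

/-- If the source had degree one, both sides of the root edge would be in the same face.
Non-separability would then give the root vertex degree one too, and by connectedness the map would
be a single edge. -/
theorem IsPlaneBipolar.rot_opp_root_ne (hM : M.IsPlaneBipolar root) : M.rot (M.opp root) ≠ M.opp root := by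
  intro h
  have h1 : M.next root = M.opp root := h
  have h2 : M.next (M.opp root) = M.rot root := by rw [next_apply, M.opp_opp]
  have h3 : M.SameFace root (M.rot root) := by
    have := (sameFace_next (B := M) root).trans (sameFace_next _)
    rwa [h1, h2] at this
  have h4 : root = M.rot root := hM.nonSeparable _ _ (vert_rot _).symm h3
  have h5 : ∀ x, x = root ∨ x = M.opp root := by
    intro x
    have := M.connected root x
    induction this with
    | refl => exact Or.inl rfl
    | tail _ hs ih =>
      rcases ih with rfl | rfl <;> rcases hs with rfl | rfl
      · exact Or.inl h4.symm
      · exact Or.inr rfl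
      · exact Or.inr h
      · exact Or.inl (M.opp_opp _)
  have h6 := hM.two_le_numEdges
  have : Subsingleton {d : D // ¬ M.IsStem d ∧ M.out d} := by
    have key : ∀ d : {d : D // ¬ M.IsStem d ∧ M.out d}, d.1 = M.opp root := fun d =>
      (h5 d.1).resolve_left fun h => hM.not_out_root (h ▸ d.2.2)
    exact ⟨fun x y => Subtype.ext ((key x).trans (key y).symm)⟩
  have h7 : M.numEdges ≤ 1 := Finite.card_le_one_iff_subsingleton.2 this
  omega

theorem IsOpeningOf.isPartialClosure (hO : T.IsOpeningOf M root)
    (hM : M.IsPlaneBipolar root) : IsPartialClosure T M root :=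
  hO.isTree.isPartialClosure hO.closure.1 hM.root_outer

/-- A stem at the root dart would be closing, hence preceded in the contour by its opening partner;
but the root dart comes first. -/
theorem IsOpeningOf.not_isStem_root (hO : T.IsOpeningOf M root)
    (hM : M.IsPlaneBipolar root) : ¬ T.IsStem root := by
  intro h
  have P := hO.isPartialClosure hM
  have h1 := P.pos_lt_opp (M.opp root) (P.isStem_opp _ h) (hM.no_stem _)
    ((out_opp_iff (hM.no_stem _)).2 hM.not_out_root)
  rw [M.opp_opp, hO.isTree.pos_root] at h1
  exact Nat.not_lt_zero _ h1

theorem IsOpeningOf.contourWord_zero_one (hO : T.IsOpeningOf M root)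
    (hM : M.IsPlaneBipolar root) :
    (T.contourWord root)[0]? = some Letter.e ∧ (T.contourWord root)[1]? = some Letter.b := by
  have P := hO.isPartialClosure hM
  have hstem := hO.not_isStem_root hM
  have hopp := P.opp_eq root hstem
  have hout : ¬ T.out root := P.out_eq ▸ hM.not_out_root
  have hcard : 1 < Fintype.card D := Fintype.one_lt_card_iff.2 ⟨_, _, hstem⟩
  have h0 := (hO.isTree.contourLetter_iff hO.accessible (i := 0) (by omega)).2.2.2.2
    ⟨hstem, hout⟩
  refine ⟨contourWord_getElem?.2 ⟨by omega, h0⟩, contourWord_getElem?.2 ⟨hcard, ?_⟩⟩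
  have h1 : (T.next ^ 1) root = M.rot (M.opp root) := by
    rw [pow_one, next_apply, hopp, P.rot_eq]
  have hsrc : M.IsSource (M.vert ((T.next ^ 1) root)) := by
    rw [h1, vert_rot]
    exact (hM.source_iff _).2 rfl
  have ho : M.out ((T.next ^ 1) root) := hsrc.out (hM.no_stem _)
  refine (hO.isTree.contourLetter_iff hO.accessible hcard).1.2 ⟨?_, P.out_eq ▸ ho⟩
  -- The source has a unique outgoing tree dart, the half `T.opp root` of the root edge. If the
  -- second letter were an edge, its dart would be this one, and the source would have degree one.
  by_contra hs
  have h2 := (hO.isTree.vert_ne_and_out_unique hO.accessible).2 _ (T.opp root) hs (P.out_eq ▸ ho)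
    (not_isStem_opp hstem) ((out_opp_iff hstem).2 hout) (by rw [pow_one, vert_next])
  rw [h1, ← hopp] at h2
  exact hM.rot_opp_root_ne h2

theorem IsOpeningOf.exists_dyckWord_edge (hO : T.IsOpeningOf M root) :
    ∃ p : DyckWord, p.toList = (T.contourWord root).filterMap Letter.edgeStep := by
  have hT := hO.isTree
  have hU : ∀ {l : Letter}, l.edgeStep = some DyckStep.U ↔ l = Letter.e := by
    intro l; cases l <;> simp [Letter.edgeStep]
  have hD : ∀ {l : Letter}, l.edgeStep = some DyckStep.D ↔ l = Letter.ebar := by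
    intro l; cases l <;> simp [Letter.edgeStep]
  refine exists_dyckWord_of_matching _ _ _
    (fun i => T.pos root (T.opp ((T.next ^ i) root))) ?_ ?_ ?_
  · intro i hi h
    rw [hD, (hT.contourLetter_iff hO.accessible hi).2.2.1] at h
    refine ⟨?_, hU.2 ((hT.contourLetter_iff hO.accessible (hT.pos_lt _ _)).2.2.2.2 ?_)⟩
    · have := hT.pos_opp_lt hO.accessible h.1 h.2
      rwa [hT.pos_pow hi] at this
    · rw [hT.pow_pos]
      exact ⟨not_isStem_opp h.1, fun h' => (out_opp_iff h.1).1 h' h.2⟩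
  · intro i hi h
    rw [hU, (hT.contourLetter_iff hO.accessible hi).2.2.2] at h
    refine ⟨hT.pos_lt _ _, hD.2 ((hT.contourLetter_iff hO.accessible (hT.pos_lt _ _)).2.2.1.2 ?_)⟩
    rw [hT.pow_pos]
    exact ⟨not_isStem_opp h.1, (out_opp_iff h.1).2 h.2⟩
  · intro i hi _
    simp only [hT.pow_pos, T.opp_opp, hT.pos_pow hi]

theorem IsOpeningOf.exists_dyckWord_stem (hO : T.IsOpeningOf M root)
    (hM : M.IsPlaneBipolar root) :
    ∃ p : DyckWord, p.toList = (T.contourWord root).filterMap Letter.stemStep := by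
  have hT := hO.isTree
  have P := hO.isPartialClosure hM
  have hout : ∀ x, T.out (M.opp x) ↔ ¬ T.out x := fun x => by
    rw [← P.out_eq]; exact out_opp_iff (hM.no_stem x)
  have hU : ∀ {l : Letter}, l.stemStep = some DyckStep.U ↔ l = Letter.b := by
    intro l; cases l <;> simp [Letter.stemStep]
  have hD : ∀ {l : Letter}, l.stemStep = some DyckStep.D ↔ l = Letter.bbar := by
    intro l; cases l <;> simp [Letter.stemStep]
  refine exists_dyckWord_of_matching _ _ _
    (fun i => T.pos root (M.opp ((T.next ^ i) root))) ?_ ?_ ?_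
  · intro i hi h
    rw [hD, (hT.contourLetter_iff hO.accessible hi).2.1] at h
    refine ⟨?_, hU.2 ((hT.contourLetter_iff hO.accessible (hT.pos_lt _ _)).1.2 ?_)⟩
    · have := P.pos_lt_opp _ (P.isStem_opp _ h.1) (hM.no_stem _)
        (P.out_eq ▸ (hout _).2 h.2)
      rwa [M.opp_opp, hT.pos_pow hi] at this
    · rw [hT.pow_pos]
      exact ⟨P.isStem_opp _ h.1, (hout _).2 h.2⟩
  · intro i hi h
    rw [hU, (hT.contourLetter_iff hO.accessible hi).1] at h
    refine ⟨hT.pos_lt _ _, hD.2 ((hT.contourLetter_iff hO.accessible (hT.pos_lt _ _)).2.1.2 ?_)⟩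
    rw [hT.pow_pos]
    exact ⟨P.isStem_opp _ h.1, fun h' => (hout _).1 h' h.2⟩
  · intro i hi _
    simp only [hT.pow_pos, M.opp_opp, hT.pos_pow hi]

theorem IsOpeningOf.exists_ebar_between (hO : T.IsOpeningOf M root)
    (hM : M.IsPlaneBipolar root) {i j : ℕ} (hij : i < j)
    (hi : (T.contourWord root)[i]? = some Letter.b)
    (hj : (T.contourWord root)[j]? = some Letter.bbar) :
    ∃ k, i ≤ k ∧ k ≤ j ∧ (T.contourWord root)[k]? = some Letter.ebar := by
  by_contra hno
  push Not at hno
  obtain ⟨a, c, hia, hac, hcj, ha, hc, hbetween⟩ := Nat.exists_closest_pair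
    (p := fun i => (T.contourWord root)[i]? = some Letter.b)
    (q := fun i => (T.contourWord root)[i]? = some Letter.bbar) hij hi hj
  have hT := hO.isTree
  have P := hO.isPartialClosure hM
  rw [contourWord_getElem?] at ha hc
  have iffs := fun k (hk : k < Fintype.card D) => hT.contourLetter_iff hO.accessible hk
  have hsa := (iffs a ha.1).1.1 ha.2
  have hsc := (iffs c hc.1).2.1.1 hc.2
  have hedge : ∀ k, a < k → k < c →
      ¬ T.IsStem ((T.next ^ k) root) ∧ ¬ T.out ((T.next ^ k) root) := by
    intro k h1 h2
    have hk : k < Fintype.card D := h2.trans hc.1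
    have h3 := hbetween k h1 h2
    have h4 := hno k (by omega) (by omega)
    simp only [ne_eq, contourWord_getElem?, hk, true_and, iffs k hk] at h3 h4
    tauto
  have hopp : M.opp ((T.next ^ a) root) = (T.next ^ c) root := by
    refine opp_eq_of_consecutive hO.closure.1 hM.no_stem hsa.1 hsa.2 hsc.1 hsc.2 ⟨c - a, ?_, ?_⟩
    · rw [← Equiv.Perm.mul_apply, ← pow_add, Nat.sub_add_cancel hac.le]
    · intro k h0 hk
      rw [← Equiv.Perm.mul_apply, ← pow_add]
      exact (hedge _ (by omega) (by omega)).1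
  -- Only letters `e` separate the two stems. Each goes down to a child while its edge is directed
  -- up, so a directed path leads back from the closing stem to the opening one, against acyclicity.
  have hnext : ∀ k, M.vert ((T.next ^ (k + 1)) root) = M.vert (T.opp ((T.next ^ k) root)) := by
    intro k
    rw [P.vert_eq_iff, pow_succ', Equiv.Perm.mul_apply, vert_next]
  have hpath : ∀ k, a < k → k ≤ c → Relation.ReflTransGen M.Arc
      (M.vert ((T.next ^ k) root)) (M.vert ((T.next ^ a) root)) := by
    intro k h1
    induction k, h1 using Nat.le_induction with
    | base =>
      intro _
      rw [Nat.succ_eq_add_one, hnext, hsa.1]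
    | succ k h1 ih =>
      intro h2
      obtain ⟨h3, h4⟩ := hedge k h1 h2
      refine Relation.ReflTransGen.head ?_ (ih (by omega))
      rw [hnext, ← P.opp_eq _ h3]
      exact arc_of_not_out (hM.no_stem _) (P.out_eq ▸ h4)
  have harc := arc_of_out (hM.no_stem ((T.next ^ a) root)) (P.out_eq ▸ hsa.2)
  rw [hopp] at harc
  exact hM.acyclic _ (Relation.TransGen.head' harc (hpath c hac le_rfl))

theorem IsOpeningOf.exists_bbar_between (hO : T.IsOpeningOf M root)
    (hM : M.IsPlaneBipolar root) {i j : ℕ} (hi0 : 0 < i) (hij : i < j)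
    (hi : (T.contourWord root)[i]? = some Letter.e)
    (hj : (T.contourWord root)[j]? = some Letter.ebar) :
    ∃ k, i ≤ k ∧ k ≤ j ∧ (T.contourWord root)[k]? = some Letter.bbar := by
  by_contra hno
  push Not at hno
  obtain ⟨a, c, hia, hac, hcj, ha, hc, hbetween⟩ := Nat.exists_closest_pair
    (p := fun i => (T.contourWord root)[i]? = some Letter.e)
    (q := fun i => (T.contourWord root)[i]? = some Letter.ebar) hij hi hj
  have hT := hO.isTree
  have P := hO.isPartialClosure hM
  rw [contourWord_getElem?] at ha hc
  have iffs := fun k (hk : k < Fintype.card D) => hT.contourLetter_iff hO.accessible hk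
  have hsa := (iffs a ha.1).2.2.2.1 ha.2
  have hsc := (iffs c hc.1).2.2.1.1 hc.2
  have hstem : ∀ k, a < k → k < c →
      T.IsStem ((T.next ^ k) root) ∧ T.out ((T.next ^ k) root) := by
    intro k h1 h2
    have hk : k < Fintype.card D := h2.trans hc.1
    have h3 := hbetween k h1 h2
    have h4 := hno k (by omega) (by omega)
    simp only [ne_eq, contourWord_getElem?, hk, true_and, iffs k hk] at h3 h4
    tauto
  have hvert : ∀ k, a < k → k ≤ c →
      T.vert ((T.next ^ k) root) = T.vert (T.opp ((T.next ^ a) root)) := by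
    intro k h1
    induction k, h1 using Nat.le_induction with
    | base =>
      intro _
      rw [Nat.succ_eq_add_one, pow_succ', Equiv.Perm.mul_apply, vert_next]
    | succ k h1 ih =>
      intro h2
      rw [pow_succ', Equiv.Perm.mul_apply, vert_next, (hstem k h1 h2).1, ih (by omega)]
  have huniq := (hT.vert_ne_and_out_unique hO.accessible).2
  have hca : (T.next ^ c) root = T.opp ((T.next ^ a) root) :=
    huniq _ _ hsc.1 hsc.2 (not_isStem_opp hsa.1) ((out_opp_iff hsa.1).2 hsa.2)
      (hvert c hac le_rfl)
  -- The positions after `a` up to `c` are closed under rotation, so they are all the darts of the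
  -- leaf. All of them are outgoing, and the leaf is a source.
  have hrot : ∀ x, (∃ k, a < k ∧ k ≤ c ∧ (T.next ^ k) root = x) →
      ∃ k, a < k ∧ k ≤ c ∧ (T.next ^ k) root = T.rot x := by
    rintro x ⟨k, h1, h2, rfl⟩
    rcases h2.lt_or_eq with h2 | rfl
    · refine ⟨k + 1, by omega, h2, ?_⟩
      rw [pow_succ', Equiv.Perm.mul_apply, next_apply, (hstem k h1 h2).1]
    · exact ⟨a + 1, by omega, hac, by rw [pow_succ', Equiv.Perm.mul_apply, next_apply, ← hca]⟩
  have hall : ∀ x, T.vert ((T.next ^ c) root) = T.vert x →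
      ∃ k, a < k ∧ k ≤ c ∧ (T.next ^ k) root = x := by
    intro x hx
    obtain ⟨m, -, rfl⟩ := (vert_eq_iff.1 hx).exists_pow_eq'
    clear hx
    induction m with
    | zero => exact ⟨c, hac, le_rfl, rfl⟩
    | succ m ih => rw [pow_succ', Equiv.Perm.mul_apply]; exact hrot _ ih
  have hsrc : M.IsSource (M.vert ((T.next ^ c) root)) := by
    rintro ⟨u, y, h1, h2, -, h4⟩
    obtain ⟨k, h5, h6, h7⟩ := hall (M.opp y) (P.vert_eq_iff.1 h4.symm)
    have h8 : M.out (M.opp y) := by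
      rw [← h7, P.out_eq]
      rcases h6.lt_or_eq with h6 | rfl
      · exact (hstem k h5 h6).2
      · exact hsc.2
    exact (out_opp_iff h1).1 h8 h2
  -- The only source is the end of the root edge, and its unique outgoing tree dart is `T.opp root`;
  -- this forces `a = 0`.
  have hroot := hO.not_isStem_root hM
  have h1 := (hM.source_iff _).1 hsrc
  rw [P.opp_eq root hroot, P.vert_eq_iff] at h1
  have h2 := huniq _ _ hsc.1 hsc.2 (not_isStem_opp hroot)
    ((out_opp_iff hroot).2 (P.out_eq ▸ hM.not_out_root)) h1
  rw [hca] at h2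
  have h3 : (T.next ^ a) root = (T.next ^ 0) root := T.opp.injective h2
  have := hT.pow_inj ha.1 (by omega) h3
  omega

end BlossomingMap

/-! ### Noncrossing matchings -/

/-- An involution whose arcs do not cross. -/
structure Noncrossing {n : ℕ} (m : Equiv.Perm (Fin n)) : Prop where
  apply_apply : ∀ x, m (m x) = x
  nested : ∀ x y, x < y → y < m x → x < m y ∧ m y < m x

namespace Noncrossing

/-- `x` lies below the arc that ends in `d`; the first end of the arc is left out. -/
def InArc {n : ℕ} (m : Equiv.Perm (Fin n)) (d x : Fin n) : Prop := m d < x ∧ x ≤ d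

/-- `x` and `y` lie below the same arcs. -/
def SameLevel {n : ℕ} (m : Equiv.Perm (Fin n)) (x y : Fin n) : Prop :=
  ∀ d, InArc m d x ↔ InArc m d y

section

variable {n : ℕ} {m : Equiv.Perm (Fin n)}

theorem inArc_def {d x : Fin n} : InArc m d x ↔ (m d).val < x.val ∧ x.val ≤ d.val := Iff.rfl

theorem SameLevel.symm {x y : Fin n} (h : SameLevel m x y) : SameLevel m y x :=
  fun d => (h d).symm

theorem SameLevel.trans {x y z : Fin n} (h : SameLevel m x y) (h' : SameLevel m y z) :
    SameLevel m x z := fun d => (h d).trans (h' d)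

theorem val_nested (hm : Noncrossing m) (d x : Fin n) (h1 : (m d).val < x.val)
    (h2 : x.val < d.val) : (m d).val < (m x).val ∧ (m x).val < d.val := by
  have := hm.nested (m d) x h1 (by rw [hm.apply_apply]; exact h2)
  rwa [hm.apply_apply] at this

theorem val_nested' (hm : Noncrossing m) (d x : Fin n) (h1 : (m d).val < (m x).val)
    (h2 : (m x).val < d.val) : (m d).val < x.val ∧ x.val < d.val := by
  have := hm.val_nested d (m x) h1 h2
  rwa [hm.apply_apply] at this

theorem val_eq_iff (m : Equiv.Perm (Fin n)) (x y : Fin n) :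
    x.val = y.val ↔ (m x).val = (m y).val := by
  rw [← Fin.ext_iff, ← Fin.ext_iff, m.injective.eq_iff]

theorem val_eq_apply_iff (hm : Noncrossing m) (x y : Fin n) :
    (m x).val = y.val ↔ x.val = (m y).val := by
  rw [val_eq_iff m, hm.apply_apply]

/-- An innermost arc above `x` is above the same darts as its last end. -/
theorem sameLevel_of_min (hm : Noncrossing m) {d x : Fin n} (h : InArc m d x)
    (hmin : ∀ d', InArc m d' x → d ≤ d') : SameLevel m x d := by
  intro a
  have h1 := hm.val_nested a d
  have h2 := hm.val_nested a x
  have h3 := val_eq_iff m a d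
  have h4 := hmin a
  have h5 := hm.val_nested' a d
  simp only [inArc_def, Fin.le_def] at *
  omega

theorem exists_min_inArc {x : Fin n} (h : ∃ d, InArc m d x) :
    ∃ d, InArc m d x ∧ ∀ d', InArc m d' x → d ≤ d' := by
  classical
  obtain ⟨d, hd⟩ := h
  obtain ⟨a, ha, hmin⟩ := (Finset.univ.filter fun d => InArc m d x).exists_min_image id
    ⟨d, by simpa using hd⟩
  exact ⟨a, by simpa using ha, fun d' hd' => hmin d' (by simpa using hd')⟩

theorem sameLevel_of_forall_not {x y : Fin n} (hx : ∀ d, ¬ InArc m d x)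
    (hy : ∀ d, ¬ InArc m d y) : SameLevel m x y := fun d => iff_of_false (hx d) (hy d)

end

variable {N : ℕ} {m : Equiv.Perm (Fin (N + 1))}

theorem not_inArc_zero (d : Fin (N + 1)) : ¬ InArc m d 0 := fun h => Nat.not_lt_zero _ h.1

/-- Follow the arc that starts in `x`, if any, then move to the next position. -/
def jump (m : Equiv.Perm (Fin (N + 1))) : Equiv.Perm (Fin (N + 1)) := finRotate (N + 1) * m

theorem val_finRotate (x : Fin (N + 1)) :
    (x.val = N ∧ (finRotate (N + 1) x).val = 0) ∨
      (x.val < N ∧ (finRotate (N + 1) x).val = x.val + 1) := by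
  rcases (Nat.lt_succ_iff.1 x.2).lt_or_eq with h | h
  · exact Or.inr ⟨h, coe_finRotate_of_ne_last fun h' => by rw [h'] at h; simp at h⟩
  · obtain rfl : x = Fin.last N := Fin.ext h
    exact Or.inl ⟨rfl, by simp⟩

theorem val_jump (m : Equiv.Perm (Fin (N + 1))) (x : Fin (N + 1)) :
    ((m x).val = N ∧ (jump m x).val = 0) ∨
      ((m x).val < N ∧ (jump m x).val = (m x).val + 1) := val_finRotate (m x)

/-- This is what the half-open convention in `InArc` is for: the start of an arc and the position
after its end are both outside it, while its end and the position after its start are both inside.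
-/
theorem sameLevel_jump (hm : Noncrossing m) (x : Fin (N + 1)) : SameLevel m x (jump m x) := by
  intro d
  have h1 := hm.val_nested d x
  have h2 := hm.val_nested' d x
  have h3 := val_eq_iff m x d
  have h4 := val_jump m x
  have h5 := d.2
  simp only [inArc_def]
  omega

/-- Jumps lead from any position to any later one of the same level. -/
theorem exists_pow_jump (hm : Noncrossing m) {x y : Fin (N + 1)} (hxy : x ≤ y)
    (h : SameLevel m x y) :
    ∃ l, (jump m ^ l) x = y ∧ ∀ i, i < l → (0 < i → x < (jump m ^ i) x) ∧
      (jump m ^ i) x < y := by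
  induction hk : y.val - x.val using Nat.strong_induction_on generalizing x with
  | _ k ih =>
    subst hk
    rcases hxy.eq_or_lt with rfl | hlt
    · exact ⟨0, rfl, fun i hi => absurd hi (Nat.not_lt_zero _)⟩
    · have h1 := h x
      have h2 := h (m x)
      have h3 := val_jump m x
      have h5 := y.2
      simp only [inArc_def, hm.apply_apply] at h1 h2
      have hlt' : x.val < y.val := hlt
      -- An arc that ends in `x` would lie above `x` but not above `y`, so the jump goes forward. An
      -- arc that starts in `x` and ends at `y` or later would lie above `y` but not above `x`, so
      -- the jump does not pass `y`.
      have h4 : x.val < (jump m x).val ∧ (jump m x).val ≤ y.val := by omega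
      obtain ⟨l, hl, hl'⟩ := ih _ (by omega) h4.2 ((hm.sameLevel_jump x).symm.trans h) rfl
      refine ⟨l + 1, by rw [pow_succ, Equiv.Perm.mul_apply, hl], fun i hi => ?_⟩
      rcases i with _ | i
      · exact ⟨fun h => absurd h (lt_irrefl _), hlt⟩
      · rw [pow_succ, Equiv.Perm.mul_apply]
        obtain ⟨h6, h7⟩ := hl' i (by omega)
        refine ⟨fun _ => ?_, h7⟩
        rcases Nat.eq_zero_or_pos i with rfl | h8
        · exact h4.1
        · exact lt_trans (show x < jump m x from h4.1) (h6 h8)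

theorem sameCycle_jump_iff (hm : Noncrossing m) {x y : Fin (N + 1)} :
    (jump m).SameCycle x y ↔ SameLevel m x y := by
  constructor
  · intro h
    obtain ⟨i, -, rfl⟩ := h.exists_pow_eq'
    clear h
    induction i with
    | zero => exact fun _ => Iff.rfl
    | succ i ih =>
      rw [pow_succ', Equiv.Perm.mul_apply]
      exact ih.trans (hm.sameLevel_jump _)
  · intro h
    have key : ∀ {x y}, x ≤ y → SameLevel m x y → (jump m).SameCycle x y := by
      intro x y hxy h
      obtain ⟨l, hl, -⟩ := hm.exists_pow_jump hxy h
      exact ⟨l, by simpa using hl⟩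
    rcases le_total x y with h' | h'
    · exact key h' h
    · exact (key h' h.symm).symm

/-- Each level is represented either by the last end of its innermost arc or, outside all arcs, by
position `0`. -/
theorem card_quotient_jump (hm : Noncrossing m) :
    Nat.card (Quotient (Equiv.Perm.SameCycle.setoid (jump m))) =
      Nat.card {d // m d < d} + 1 := by
  let f : Option {d // m d < d} → Quotient (Equiv.Perm.SameCycle.setoid (jump m)) := fun o =>
    Quotient.mk _ (o.elim 0 Subtype.val)
  have hf : ∀ o o', f o = f o' ↔ SameLevel m (o.elim 0 Subtype.val) (o'.elim 0 Subtype.val) :=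
    fun o o' => Quotient.eq.trans hm.sameCycle_jump_iff
  have hbij : Function.Bijective f := by
    constructor
    · intro o o' h
      rw [hf] at h
      rcases o with _ | ⟨d, hd⟩ <;> rcases o' with _ | ⟨d', hd'⟩
      · rfl
      · exact absurd ((h d').2 ⟨hd', le_rfl⟩) (not_inArc_zero _)
      · exact absurd ((h d).1 ⟨hd, le_rfl⟩) (not_inArc_zero _)
      · have h1 := (h d).1 ⟨hd, le_rfl⟩
        have h2 := (h d').2 ⟨hd', le_rfl⟩
        have h3 : d = d' := le_antisymm h2.2 h1.2
        subst h3
        rfl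
    · intro q
      induction q using Quotient.inductionOn with
      | _ x =>
        by_cases hx : ∃ d, InArc m d x
        · obtain ⟨d, hd, hmin⟩ := exists_min_inArc hx
          exact ⟨some ⟨d, hd.1.trans_le hd.2⟩,
            Quotient.sound (hm.sameCycle_jump_iff.2 (hm.sameLevel_of_min hd hmin).symm)⟩
        · exact ⟨none, Quotient.sound (hm.sameCycle_jump_iff.2
            (sameLevel_of_forall_not not_inArc_zero (not_exists.1 hx)))⟩
  rw [← Nat.card_congr (Equiv.ofBijective f hbij), Finite.card_option]

end Noncrossing

/-! ### From Dyck words to noncrossing matchings -/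

/-- A nonnegative path from `0` to `0` matches up-steps with down-steps. -/
theorem exists_noncrossing_of_height (n : ℕ) (H : ℕ → ℤ) (h0 : H 0 = 0) (hn : H n = 0)
    (hpos : ∀ k ≤ n, 0 ≤ H k) (hstep : ∀ k < n, -1 ≤ H (k + 1) - H k ∧ H (k + 1) - H k ≤ 1) :
    ∃ m : Equiv.Perm (Fin n), Noncrossing m ∧ ∀ x : Fin n,
      (H (x + 1) = H x → m x = x) ∧
      (H (x + 1) = H x + 1 → x < m x) ∧ (H (x + 1) = H x - 1 → m x < x) := by
  -- The up-step `i` is matched with the down-step `j` that first returns to height `H i`. Read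
  -- backwards, `i` is the last time before `j` at which the height is at most `H (j + 1)`.
  let R : ℕ → ℕ → Prop := fun i j => i < j ∧ H (i + 1) = H i + 1 ∧ H (j + 1) = H j - 1 ∧
    H (j + 1) = H i ∧ ∀ k, i < k → k ≤ j → H i < H k
  have hup : ∀ i < n, H (i + 1) = H i + 1 → ∃ j < n, R i j := by
    intro i hi hH
    have hex : ∃ k, i < k ∧ H k ≤ H i := ⟨n, hi, by rw [hn]; exact hpos i hi.le⟩
    classical
    obtain ⟨h1, h2⟩ := Nat.find_spec hex
    have h3 : ∀ k, k < Nat.find hex → i < k → H i < H k := fun k hk hik => by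
      have := Nat.find_min hex hk
      push Not at this
      exact this hik
    have h4 : Nat.find hex ≤ n := Nat.find_min' hex ⟨hi, by rw [hn]; exact hpos i hi.le⟩
    obtain ⟨j, hj⟩ : ∃ j, Nat.find hex = j + 1 := ⟨Nat.find hex - 1, by omega⟩
    rw [hj] at h1 h2 h3 h4
    have h5 : i < j := by
      rcases (Nat.lt_succ_iff.1 h1).lt_or_eq with h | h
      · exact h
      · rw [h] at hH h2; omega
    have h6 := h3 j (by omega) h5
    have h7 := hstep j h4
    exact ⟨j, h4, h5, hH, by omega, by omega, fun k hk hkj => h3 k (by omega) hk⟩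
  have hdown : ∀ j < n, H (j + 1) = H j - 1 → ∃ i < n, R i j := by
    intro j hj hH
    classical
    have h1 : H (Nat.findGreatest (fun k => H k ≤ H (j + 1)) j) ≤ H (j + 1) :=
      Nat.findGreatest_spec (P := fun k => H k ≤ H (j + 1)) (Nat.zero_le j)
        (by rw [h0]; exact hpos _ hj)
    have h2 : ∀ k, Nat.findGreatest (fun k => H k ≤ H (j + 1)) j < k → k ≤ j → H (j + 1) < H k :=
      fun k hk hkj => not_le.1 (Nat.findGreatest_is_greatest hk hkj)
    have h3 : Nat.findGreatest (fun k => H k ≤ H (j + 1)) j ≤ j := Nat.findGreatest_le j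
    generalize Nat.findGreatest (fun k => H k ≤ H (j + 1)) j = i at h1 h2 h3
    have h4 : i < j := by
      rcases h3.lt_or_eq with h | h
      · exact h
      · rw [h] at h1; omega
    have h5 := h2 (i + 1) (by omega) h4
    have h6 := hstep i (by omega)
    refine ⟨i, by omega, h4, by omega, hH, by omega, fun k hk hkj => ?_⟩
    have := h2 k hk hkj
    omega
  have huniq : ∀ i j j', R i j → R i j' → j = j' := by
    rintro i j j' ⟨h1, h2, h3, h4, h5⟩ ⟨h1', h2', h3', h4', h5'⟩
    rcases lt_trichotomy j j' with h | h | h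
    · have := h5' (j + 1) (by omega) h; omega
    · exact h
    · have := h5 (j' + 1) (by omega) h; omega
  have huniq' : ∀ i i' j, R i j → R i' j → i = i' := by
    rintro i i' j ⟨h1, h2, h3, h4, h5⟩ ⟨h1', h2', h3', h4', h5'⟩
    rcases lt_trichotomy i i' with h | h | h
    · have := h5 i' h h1'.le; omega
    · exact h
    · have := h5' i h h1.le; omega
  have hnest : ∀ i j i' j', R i j → R i' j' → i < i' → i' < j → j' < j := by
    rintro i j i' j' ⟨h1, h2, h3, h4, h5⟩ ⟨h1', h2', h3', h4', h5'⟩ h6 h7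
    by_contra h8
    have h9 := h5 i' h6 h7.le
    rcases (not_lt.1 h8).lt_or_eq with h | h
    · have := h5' (j + 1) (by omega) h; omega
    · rw [← h] at h4'; omega
  let S : ℕ → ℕ → Prop := fun i j => R i j ∨ R j i ∨ (i = j ∧ H (i + 1) = H i)
  have hS : ∀ i : Fin n, ∃ j : Fin n, S i j := by
    intro i
    have h := hstep i i.2
    rcases (by omega : H (i + 1) = H i ∨ H (i + 1) = H i + 1 ∨ H (i + 1) = H i - 1) with h | h | h
    · exact ⟨i, Or.inr (Or.inr ⟨rfl, h⟩)⟩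
    · obtain ⟨j, hj, hR⟩ := hup i i.2 h
      exact ⟨⟨j, hj⟩, Or.inl hR⟩
    · obtain ⟨j, hj, hR⟩ := hdown i i.2 h
      exact ⟨⟨j, hj⟩, Or.inr (Or.inl hR)⟩
  have hSsymm : ∀ i j, S i j → S j i := by
    rintro i j (h | h | ⟨rfl, h⟩)
    · exact Or.inr (Or.inl h)
    · exact Or.inl h
    · exact Or.inr (Or.inr ⟨rfl, h⟩)
  have hSuniq : ∀ i j j', S i j → S i j' → j = j' := by
    rintro i j j' (h | h | h) (h' | h' | h')
    · exact huniq _ _ _ h h'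
    · have := h.2.1; have := h'.2.2.1; omega
    · have := h.2.1; omega
    · have := h.2.2.1; have := h'.2.1; omega
    · exact huniq' _ _ _ h h'
    · have := h.2.2.1; omega
    · have := h'.2.1; omega
    · have := h'.2.2.1; omega
    · omega
  choose f hf using hS
  have hff : ∀ x, f (f x) = x := fun x =>
    Fin.ext (hSuniq _ _ _ (hf (f x)) (hSsymm _ _ (hf x)))
  have hcases : ∀ x : Fin n, (H (x + 1) = H x ∧ f x = x) ∨ (H (x + 1) = H x + 1 ∧ R x (f x)) ∨
      (H (x + 1) = H x - 1 ∧ R (f x) x) := by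
    intro x
    rcases hf x with h | h | ⟨h, h'⟩
    · exact Or.inr (Or.inl ⟨h.2.1, h⟩)
    · exact Or.inr (Or.inr ⟨h.2.2.1, h⟩)
    · exact Or.inl ⟨h', Fin.ext h.symm⟩
  refine ⟨Function.Involutive.toPerm f hff, ⟨hff, ?_⟩, ?_⟩
  · intro x y hxy hyx
    change y < f x at hyx
    change x < f y ∧ f y < f x
    have hx : R x (f x) := by
      rcases hcases x with ⟨_, h⟩ | ⟨_, h⟩ | ⟨_, h⟩
      · rw [h] at hyx; exact absurd (hxy.trans hyx) (lt_irrefl _)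
      · exact h
      · exact absurd (hxy.trans hyx) (not_lt.2 (Fin.le_def.2 h.1.le))
    rcases hcases y with ⟨_, h⟩ | ⟨_, h⟩ | ⟨_, h⟩
    · rw [h]; exact ⟨hxy, hyx⟩
    · exact ⟨hxy.trans (Fin.lt_def.2 h.1), Fin.lt_def.2 (hnest _ _ _ _ hx h hxy hyx)⟩
    · refine ⟨?_, (Fin.lt_def.2 h.1).trans hyx⟩
      by_contra h1
      rcases (not_lt.1 h1).lt_or_eq with h2 | h2
      · exact absurd (hnest _ _ _ _ h hx h2 hxy) (not_lt.2 (Fin.le_def.1 hyx.le))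
      · rw [← h2, hff] at hyx
        exact lt_irrefl _ hyx
  · intro x
    change (_ → f x = x) ∧ (_ → x < f x) ∧ (_ → f x < x)
    rcases hcases x with ⟨h, h'⟩ | ⟨h, h'⟩ | ⟨h, h'⟩
    · exact ⟨fun _ => h', by omega, by omega⟩
    · exact ⟨by omega, fun _ => h'.1, by omega⟩
    · exact ⟨by omega, by omega, fun _ => h'.1⟩

/-- The height is the excess of up-steps over down-steps in a prefix. Letters outside the
restriction are level steps, hence fixed points, so the matching lives on the positions of the full
word. -/
theorem exists_noncrossing_of_dyckWord {α : Type} {n : ℕ} (s : α → Option DyckStep)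
    (l : Fin n → α) (p : DyckWord) (hp : p.toList = (List.ofFn l).filterMap s) :
    ∃ m : Equiv.Perm (Fin n), Noncrossing m ∧ ∀ x : Fin n,
      (s (l x) = none → m x = x) ∧
      (s (l x) = some DyckStep.U → x < m x) ∧ (s (l x) = some DyckStep.D → m x < x) := by
  let c : DyckStep → ℕ → ℤ := fun y k => ((((List.ofFn l).take k).filterMap s).count y : ℤ)
  have hsucc : ∀ y (x : Fin n), c y (x + 1) = c y x + if s (l x) = some y then 1 else 0 := by
    intro y x
    have h1 : (List.ofFn l).take (x + 1) = (List.ofFn l).take x ++ [l x] := by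
      rw [List.take_add_one]
      simp
    simp only [c, h1, List.filterMap_append, List.count_append]
    rcases h : s (l x) with _ | z
    · simp [h]
    · by_cases hz : z = y
      · simp [h, hz]
      · simp [h, hz]
  have htake : ∀ k, ∃ i, ((List.ofFn l).take k).filterMap s = p.toList.take i := by
    intro k
    refine ⟨(((List.ofFn l).take k).filterMap s).length, ?_⟩
    have : (List.ofFn l).filterMap s = ((List.ofFn l).take k).filterMap s ++
        ((List.ofFn l).drop k).filterMap s := by
      rw [← List.filterMap_append, List.take_append_drop]
    rw [hp, this, List.take_left]
  have hn : c DyckStep.U n - c DyckStep.D n = 0 := by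
    have : (List.ofFn l).take n = List.ofFn l := List.take_of_length_le (by simp)
    simp only [c, this, ← hp, p.count_U_eq_count_D, sub_self]
  have hpos : ∀ k ≤ n, 0 ≤ c DyckStep.U k - c DyckStep.D k := by
    intro k hk
    obtain ⟨i, hi⟩ := htake k
    have := p.count_D_le_count_U i
    simp only [c, hi]
    omega
  have hstep : ∀ k < n, -1 ≤ c DyckStep.U (k + 1) - c DyckStep.D (k + 1) -
      (c DyckStep.U k - c DyckStep.D k) ∧ c DyckStep.U (k + 1) - c DyckStep.D (k + 1) -
      (c DyckStep.U k - c DyckStep.D k) ≤ 1 := by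
    intro k hk
    have hU := hsucc DyckStep.U ⟨k, hk⟩
    have hD := hsucc DyckStep.D ⟨k, hk⟩
    simp only at hU hD
    rcases h : s (l ⟨k, hk⟩) with _ | _ | _ <;> simp [h] at hU hD <;> omega
  obtain ⟨m, hm, h⟩ := exists_noncrossing_of_height n
    (fun k => c DyckStep.U k - c DyckStep.D k) (by simp [c]) hn hpos hstep
  refine ⟨m, hm, fun x => ?_⟩
  have hU := hsucc DyckStep.U x
  have hD := hsucc DyckStep.D x
  obtain ⟨h1, h2, h3⟩ := h x
  refine ⟨fun h => h1 ?_, fun h => h2 ?_, fun h => h3 ?_⟩ <;> simp [h] at hU hD <;> omega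

/-! ### Truncated matchings -/

namespace Noncrossing

variable {n : ℕ} {m : Equiv.Perm (Fin n)}

/-- Only the arcs with both ends before `k`. -/
def trunc (hm : Noncrossing m) (k : ℕ) : Equiv.Perm (Fin n) :=
  Function.Involutive.toPerm (fun x => if x.val < k ∧ (m x).val < k then m x else x) <| by
    intro x
    dsimp only
    by_cases h : x.val < k ∧ (m x).val < k
    · rw [if_pos h, if_pos (by rw [hm.apply_apply]; exact h.symm), hm.apply_apply]
    · rw [if_neg h, if_neg h]

theorem trunc_apply (hm : Noncrossing m) (k : ℕ) (x : Fin n) :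
    hm.trunc k x = if x.val < k ∧ (m x).val < k then m x else x := rfl

theorem trunc_of_lt (hm : Noncrossing m) {k : ℕ} {x : Fin n} (h : x.val < k)
    (h' : (m x).val < k) : hm.trunc k x = m x := if_pos ⟨h, h'⟩

theorem trunc_eq_or (hm : Noncrossing m) (k : ℕ) (x : Fin n) :
    (hm.trunc k x = m x ∧ x.val < k ∧ (m x).val < k) ∨
      (hm.trunc k x = x ∧ ¬ (x.val < k ∧ (m x).val < k)) := by
  by_cases h : x.val < k ∧ (m x).val < k
  · exact Or.inl ⟨if_pos h, h⟩
  · exact Or.inr ⟨if_neg h, h⟩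

theorem trunc_zero (hm : Noncrossing m) : hm.trunc 0 = 1 := by
  ext x
  simp [trunc_apply]

theorem trunc_of_le (hm : Noncrossing m) {k : ℕ} (hk : n ≤ k) : hm.trunc k = m := by
  ext x
  rw [trunc_of_lt hm (by omega) (by omega)]

theorem noncrossing_trunc (hm : Noncrossing m) (k : ℕ) : Noncrossing (hm.trunc k) := by
  refine ⟨fun x => ?_, fun x y hxy hy => ?_⟩
  · rcases hm.trunc_eq_or k x with ⟨h, h1, h2⟩ | ⟨h, -⟩
    · rw [h, trunc_of_lt hm h2 (by rwa [hm.apply_apply]), hm.apply_apply]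
    · rw [h, h]
  · rcases hm.trunc_eq_or k x with ⟨h, h1, h2⟩ | ⟨h, -⟩
    · rw [h] at hy ⊢
      have h3 := hm.nested x y hxy hy
      rw [trunc_of_lt hm]
      · exact h3
      · exact lt_trans hy h2
      · exact lt_trans h3.2 h2
    · rw [h] at hy
      exact absurd (hxy.trans hy) (lt_irrefl _)

theorem noncrossing_one : Noncrossing (1 : Equiv.Perm (Fin n)) :=
  ⟨fun _ => rfl, fun _ _ h h' => absurd (h.trans h') (lt_irrefl _)⟩

/-- The factor between two positions of the same level is stable under the matching. -/
theorem le_apply_and_lt_of_sameLevel (hm : Noncrossing m) {x y z : Fin n}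
    (h : SameLevel m x y) (hxz : x ≤ z) (hzy : z < y) : x ≤ m z ∧ m z < y := by
  have h1 := h z
  have h2 := h (m z)
  simp only [inArc_def, hm.apply_apply, Fin.le_def, Fin.lt_def] at *
  omega

end Noncrossing

/-! ### Pairs of matchings and the descent argument -/

open Noncrossing

variable {N : ℕ} {me mb : Equiv.Perm (Fin (N + 1))}

/-- The matchings of the edge letters and of the stem letters in the contour word of the blossoming
tree of a plane bipolar orientation. -/
structure IsBipolarPair (me mb : Equiv.Perm (Fin (N + 1))) : Prop where
  edge : Noncrossing me
  stem : Noncrossing mb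
  edge_eq_iff : ∀ x, me x = x ↔ mb x ≠ x
  zero_lt : 0 < me 0
  one_lt : ∀ x : Fin (N + 1), x.val = 1 → x < mb x
  exists_ebar : ∀ i j, i < j → i < mb i → mb j < j → ∃ k, i ≤ k ∧ k ≤ j ∧ me k < k
  exists_bbar : ∀ i j, 0 < i → i < j → i < me i → me j < j → ∃ k, i ≤ k ∧ k ≤ j ∧ mb k < k

namespace IsBipolarPair

theorem stem_eq (h : IsBipolarPair me mb) {x : Fin (N + 1)} (hx : me x ≠ x) : mb x = x :=
  not_not.1 fun h' => hx ((h.edge_eq_iff x).2 h')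

theorem edge_eq (h : IsBipolarPair me mb) {x : Fin (N + 1)} (hx : mb x ≠ x) : me x = x :=
  (h.edge_eq_iff x).2 hx

theorem exists_ebar_lt (h : IsBipolarPair me mb) {i j : Fin (N + 1)} (hij : i < j)
    (hi : i < mb i) (hj : mb j < j) : ∃ k, i < k ∧ k < j ∧ me k < k := by
  obtain ⟨k, h1, h2, h3⟩ := h.exists_ebar i j hij hi hj
  refine ⟨k, h1.lt_of_ne ?_, h2.lt_of_ne ?_, h3⟩
  · rintro rfl; rw [h.edge_eq hi.ne'] at h3; exact lt_irrefl _ h3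
  · rintro rfl; rw [h.edge_eq hj.ne] at h3; exact lt_irrefl _ h3

theorem exists_bbar_lt (h : IsBipolarPair me mb) {i j : Fin (N + 1)} (h0 : 0 < i) (hij : i < j)
    (hi : i < me i) (hj : me j < j) : ∃ k, i < k ∧ k < j ∧ mb k < k := by
  obtain ⟨k, h1, h2, h3⟩ := h.exists_bbar i j h0 hij hi hj
  refine ⟨k, h1.lt_of_ne ?_, h2.lt_of_ne ?_, h3⟩
  · rintro rfl; rw [h.stem_eq hi.ne'] at h3; exact lt_irrefl _ h3
  · rintro rfl; rw [h.stem_eq hj.ne] at h3; exact lt_irrefl _ h3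

theorem exists_least {p : Fin (N + 1) → Prop} (h : ∃ x, p x) : ∃ x, p x ∧ ∀ y, p y → x ≤ y := by
  classical
  obtain ⟨d, hd⟩ := h
  obtain ⟨a, ha, hmin⟩ := (Finset.univ.filter p).exists_min_image id ⟨d, by simpa using hd⟩
  exact ⟨a, by simpa using ha, fun d' hd' => hmin d' (by simpa using hd')⟩

/-- The first `ē` after an opening stem comes before the matching closing stem, and it
closes an edge that was opened before the stem. -/
theorem exists_first_ebar (h : IsBipolarPair me mb) {p : Fin (N + 1)} (hp : p < mb p) :
    ∃ d, p < d ∧ d < mb p ∧ me d < p ∧ ∀ d', p < d' → me d' < d' → d ≤ d' := by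
  obtain ⟨k, hk1, hk2, hk3⟩ := h.exists_ebar_lt hp hp (by rw [h.stem.apply_apply]; exact hp)
  obtain ⟨d, ⟨hd1, hd2⟩, hmin⟩ := exists_least (p := fun d => p < d ∧ me d < d) ⟨k, hk1, hk3⟩
  have hd3 : d < mb p := (hmin k ⟨hk1, hk3⟩).trans_lt hk2
  refine ⟨d, hd1, hd3, ?_, fun d' h1 h2 => hmin d' ⟨h1, h2⟩⟩
  -- Otherwise the edge closed by `d` is opened after `p`, and (5) puts a `bbar` inside it. By
  -- noncrossing, the partner of this `bbar` also comes after `p`, and (4) gives an `ebar` before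
  -- `d`.
  by_contra hlt
  have hne : p ≠ me d := by
    rintro h1
    have h2 : d = p := by
      rw [← h.edge.apply_apply d, ← h1, h.edge_eq hp.ne']
    exact hd1.ne' h2
  have hpd : p < me d := (not_lt.1 hlt).lt_of_ne hne
  obtain ⟨k', h1, h2, h3⟩ := h.exists_bbar_lt ((Fin.zero_le p).trans_lt hpd) hd2
    (by rwa [h.edge.apply_apply]) hd2
  have h4 := h.stem.nested p k' (hpd.trans h1) (h2.trans hd3)
  obtain ⟨r, h5, h6, h7⟩ := h.exists_ebar_lt h3 (by rwa [h.stem.apply_apply]) h3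
  exact absurd (hmin r ⟨h4.1.trans h5, h7⟩) (not_le.2 (h6.trans h2))

/-- No factor that leaves out the first letter is balanced for both pairs of letters. -/
theorem not_balanced (h : IsBipolarPair me mb) {i : Fin (N + 1)} (hi : 0 < i)
    {p : Fin (N + 1) → Prop} (hp : p i) (hle : ∀ x, p x → i ≤ x)
    (hconv : ∀ x y, p y → i ≤ x → x ≤ y → p x)
    (he : ∀ x, p x → p (me x)) (hb : ∀ x, p x → p (mb x)) : False := by
  have hex : ∃ r, p r ∧ me r < r := by
    by_cases h1 : me i = i
    · have h2 : i < mb i := (hle _ (hb i hp)).lt_of_ne ((h.edge_eq_iff i).1 h1).symm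
      obtain ⟨k, h3, h4, h5⟩ := h.exists_ebar_lt h2 h2 (by rwa [h.stem.apply_apply])
      exact ⟨k, hconv _ _ (hb i hp) h3.le h4.le, h5⟩
    · refine ⟨me i, he i hp, ?_⟩
      rw [h.edge.apply_apply]
      exact (hle _ (he i hp)).lt_of_ne (Ne.symm h1)
  -- The same descent from the first `ebar` of the factor; balance keeps the partners inside it.
  obtain ⟨r, ⟨hr1, hr2⟩, hmin⟩ := exists_least hex
  obtain ⟨k, h1, h2, h3⟩ := h.exists_bbar_lt (hi.trans_le (hle _ (he r hr1))) hr2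
    (by rwa [h.edge.apply_apply]) hr2
  have hk : p k := hconv _ _ hr1 ((hle _ (he r hr1)).trans h1.le) h2.le
  obtain ⟨s, h4, h5, h6⟩ := h.exists_ebar_lt h3 (by rwa [h.stem.apply_apply]) h3
  have hs : p s := hconv _ _ hk ((hle _ (hb k hk)).trans h4.le) h5.le
  exact absurd (hmin s ⟨hs, h6⟩) (not_le.2 (h5.trans h2))

/-- The factor from `x` up to, but not including, `y` is balanced for both matchings, which
contradicts `not_balanced` unless it is empty or contains the first letter. -/
theorem eq_of_sameLevel (h : IsBipolarPair me mb) {x y : Fin (N + 1)} (he : SameLevel me x y)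
    (hb : SameLevel mb x y) : x = y := by
  have key : ∀ x y, SameLevel me x y → SameLevel mb x y → ¬ x < y := by
    intro x y he hb hxy
    have hse := fun z => h.edge.le_apply_and_lt_of_sameLevel (z := z) he
    have hsb := fun z => h.stem.le_apply_and_lt_of_sameLevel (z := z) hb
    rcases eq_or_ne x 0 with rfl | hx
    · have hout : ∀ {m : Equiv.Perm (Fin (N + 1))}, Noncrossing m →
          (∀ z, 0 ≤ z → z < y → 0 ≤ m z ∧ m z < y) → ∀ z, y ≤ z → y ≤ m z := by
        intro m hm hs z hz
        by_contra hlt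
        have := (hs (m z) (Fin.zero_le _) (not_le.1 hlt)).2
        rw [hm.apply_apply] at this
        exact absurd hz (not_le.2 this)
      exact h.not_balanced hxy (p := fun z => y ≤ z) le_rfl (fun _ => id) (fun _ _ _ => fun h _ => h)
        (hout h.edge hse) (hout h.stem hsb)
    · exact h.not_balanced (Fin.pos_iff_ne_zero.2 hx) (p := fun z => x ≤ z ∧ z < y) ⟨le_rfl, hxy⟩
        (fun _ h => h.1) (fun _ _ h h1 h2 => ⟨h1, h2.trans_lt h.2⟩)
        (fun z hz => hse z hz.1 hz.2) (fun z hz => hsb z hz.1 hz.2)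
  exact le_antisymm (not_lt.1 (key _ _ he.symm hb.symm)) (not_lt.1 (key _ _ he hb))

/-! ### The partial closures -/

theorem trunc_eq_self (h : IsBipolarPair me mb) (k : ℕ) {x : Fin (N + 1)} (hx : me x ≠ x) :
    h.stem.trunc k x = x := by
  rcases h.stem.trunc_eq_or k x with ⟨h1, -⟩ | ⟨h1, -⟩
  · rw [h1, h.stem_eq hx]
  · exact h1

theorem mul_trunc_of_edge (h : IsBipolarPair me mb) (k : ℕ) {x : Fin (N + 1)} (hx : me x ≠ x) :
    (me * h.stem.trunc k) x = me x := by
  rw [Equiv.Perm.mul_apply, h.trunc_eq_self k hx]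

theorem mul_trunc_of_stem (h : IsBipolarPair me mb) (k : ℕ) {x : Fin (N + 1)} (hx : me x = x) :
    (me * h.stem.trunc k) x = h.stem.trunc k x := by
  rw [Equiv.Perm.mul_apply]
  by_contra h1
  have h2 := h.trunc_eq_self k h1
  rw [(h.stem.noncrossing_trunc k).apply_apply] at h2
  rw [← h2] at h1
  exact h1 hx

theorem mul_trunc_mul_trunc (h : IsBipolarPair me mb) (k : ℕ) (x : Fin (N + 1)) :
    (me * h.stem.trunc k) ((me * h.stem.trunc k) x) = x := by
  by_cases hx : me x = x
  · rw [h.mul_trunc_of_stem k hx, Equiv.Perm.mul_apply,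
      (h.stem.noncrossing_trunc k).apply_apply, hx]
  · rw [h.mul_trunc_of_edge k hx, h.mul_trunc_of_edge k, h.edge.apply_apply]
    rw [h.edge.apply_apply]
    exact Ne.symm hx

theorem mul_trunc_eq_iff (h : IsBipolarPair me mb) (k : ℕ) (x : Fin (N + 1)) :
    (me * h.stem.trunc k) x = x ↔ me x = x ∧ h.stem.trunc k x = x := by
  by_cases hx : me x = x
  · rw [h.mul_trunc_of_stem k hx]; simp [hx]
  · rw [h.mul_trunc_of_edge k hx]; simp [hx]

/-- The two copies of `me` cancel in `rot * opp`, so faces are to the stem matching what vertices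
are to the edge matching. -/
theorem jump_mul (h : IsBipolarPair me mb) (k : ℕ) :
    jump me * (me * h.stem.trunc k) = jump (h.stem.trunc k) := by
  ext x
  simp [jump, h.edge.apply_apply]

/-- An edge of the tree is counted at its `ebar`, a merged edge at its `b`, the partner of the last
end that indexes its arc. -/
theorem card_edges (h : IsBipolarPair me mb) (k : ℕ) :
    Nat.card {d // (me * h.stem.trunc k) d ≠ d ∧ (me d < d ∨ d < mb d)} =
      Nat.card {d // me d < d} + Nat.card {d // h.stem.trunc k d < d} := by
  have hk := h.stem.noncrossing_trunc k
  have hstem : ∀ {d}, h.stem.trunc k d ≠ d → h.stem.trunc k d = mb d ∧ mb d ≠ d := by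
    intro d hd
    rcases h.stem.trunc_eq_or k d with ⟨h1, -⟩ | ⟨h1, -⟩
    · exact ⟨h1, h1 ▸ hd⟩
    · exact absurd h1 hd
  rw [← Nat.card_sum]
  symm
  refine Nat.card_congr (Equiv.ofBijective (fun s => s.elim
    (fun d => ⟨d.1, by rw [h.mul_trunc_of_edge k d.2.ne]; exact ⟨d.2.ne, Or.inl d.2⟩⟩)
    (fun d => ⟨h.stem.trunc k d.1, ?_⟩)) ⟨?_, ?_⟩)
  · obtain ⟨h1, h2⟩ := hstem d.2.ne
    have h3 : me (h.stem.trunc k d.1) = h.stem.trunc k d.1 := by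
      rw [h1]; exact h.edge_eq fun h4 => h2 (mb.injective h4)
    rw [h.mul_trunc_of_stem k h3, hk.apply_apply]
    refine ⟨d.2.ne', Or.inr ?_⟩
    rw [h1, h.stem.apply_apply, ← h1]
    exact d.2
  · rintro (⟨d, hd⟩ | ⟨d, hd⟩) (⟨d', hd'⟩ | ⟨d', hd'⟩) heq <;>
      simp only [Sum.elim_inl, Sum.elim_inr, Subtype.mk.injEq] at heq
    · subst heq; rfl
    · exfalso
      have := h.trunc_eq_self k hd.ne
      rw [heq, hk.apply_apply] at this
      exact hd'.ne' this
    · exfalso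
      have := h.trunc_eq_self k hd'.ne
      rw [← heq, hk.apply_apply] at this
      exact hd.ne' this
    · have := (h.stem.trunc k).injective heq
      subst this; rfl
  · rintro ⟨d, hd1, hd2⟩
    by_cases hd : me d = d
    · have h1 : h.stem.trunc k d ≠ d := by rwa [h.mul_trunc_of_stem k hd] at hd1
      have h2 : d < mb d := hd2.resolve_left fun h3 => h3.ne hd
      refine ⟨Sum.inr ⟨h.stem.trunc k d, ?_⟩, Subtype.ext ?_⟩
      · rw [hk.apply_apply, (hstem h1).1]; exact h2
      · exact hk.apply_apply d
    · refine ⟨Sum.inl ⟨d, hd2.resolve_right fun h3 => ?_⟩, rfl⟩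
      exact h3.ne' (h.stem_eq hd)

/-- An arc that ends before `k` encloses only stems matched before `k`. Unmatched stems thus lie
outside all arcs, on the level of position `0`, which is the outer face. -/
theorem not_inArc_trunc (h : IsBipolarPair me mb) (k : ℕ) {x : Fin (N + 1)} (hx : me x = x)
    (hk : h.stem.trunc k x = x) (d : Fin (N + 1)) : ¬ InArc (h.stem.trunc k) d x := by
  intro hd
  rcases hd.2.eq_or_lt with rfl | h1
  · rw [InArc, hk] at hd
    exact lt_irrefl _ hd.1
  · have h2 := hd.1
    rcases h.stem.trunc_eq_or k d with ⟨h3, h4, -⟩ | ⟨h3, -⟩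
    · rw [h3] at h2
      have h5 := h.stem.val_nested d x h2 h1
      rw [h.stem.trunc_of_lt (lt_trans h1 h4) (lt_trans h5.2 h4)] at hk
      exact (h.edge_eq_iff x).1 hx hk
    · rw [h3] at h2
      exact absurd (h2.trans h1) (lt_irrefl _)

/-- The map obtained from the blossoming tree by merging the stems that are matched
before position `k`. -/
def partialMap (h : IsBipolarPair me mb) (k : ℕ) : BlossomingMap (Fin (N + 1)) where
  rot := jump me
  opp := me * h.stem.trunc k
  opp_opp := h.mul_trunc_mul_trunc k
  out x := me x < x ∨ x < mb x
  out_opp x hx := by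
    by_cases hs : me x = x
    · have hmb := (h.edge_eq_iff x).1 hs
      rw [h.mul_trunc_of_stem k hs] at hx ⊢
      rcases h.stem.trunc_eq_or k x with ⟨h1, -⟩ | ⟨h1, -⟩
      · rw [h1, h.stem.apply_apply, h.edge_eq (x := mb x) fun h2 => hmb (mb.injective h2), hs]
        simp only [lt_self_iff_false, false_or, not_lt]
        exact ⟨fun h => h.le, fun h => h.lt_of_ne hmb⟩
      · exact absurd h1 hx
    · rw [h.mul_trunc_of_edge k hs, h.edge.apply_apply,
        h.stem_eq (x := me x) fun h2 => hs (me.injective h2), h.stem_eq hs]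
      simp only [lt_self_iff_false, or_false, not_lt]
      exact ⟨fun h => h.le, fun h => h.lt_of_ne (Ne.symm hs)⟩
  outer := 0
  stem_outer x hx := by
    rw [h.mul_trunc_eq_iff] at hx
    rw [h.jump_mul, (h.stem.noncrossing_trunc k).sameCycle_jump_iff]
    exact sameLevel_of_forall_not not_inArc_zero (h.not_inArc_trunc k hx.1 hx.2)
  connected x y := by
    -- Tree edges alone suffice: `jump 1` is the tree contour, and each of its steps is a rotation,
    -- possibly after crossing an edge.
    have hstep : ∀ x, Relation.ReflTransGen
        (fun x y => y = jump me x ∨ y = (me * h.stem.trunc k) x) x (jump 1 x) := by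
      intro x
      by_cases hx : me x = x
      · refine Relation.ReflTransGen.single (Or.inl ?_)
        simp [jump, hx]
      · refine Relation.ReflTransGen.tail (Relation.ReflTransGen.single (Or.inr rfl)) (Or.inl ?_)
        rw [h.mul_trunc_of_edge k hx]
        simp [jump, h.edge.apply_apply]
    have hcycle : (jump (1 : Equiv.Perm (Fin (N + 1)))).SameCycle x y :=
      noncrossing_one.sameCycle_jump_iff.2 (sameLevel_of_forall_not
        (fun d hd => absurd (hd.1.trans_le hd.2) (lt_irrefl _))
        (fun d hd => absurd (hd.1.trans_le hd.2) (lt_irrefl _)))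
    obtain ⟨i, -, rfl⟩ := hcycle.exists_pow_eq'
    clear hcycle
    induction i with
    | zero => exact Relation.ReflTransGen.refl
    | succ i ih =>
      rw [pow_succ', Equiv.Perm.mul_apply]
      exact ih.trans (hstep _)
  euler := by
    rw [h.jump_mul, h.edge.card_quotient_jump, (h.stem.noncrossing_trunc k).card_quotient_jump,
      h.card_edges k]
    omega

section

variable (h : IsBipolarPair me mb) (k : ℕ)

theorem isStem_partialMap {x : Fin (N + 1)} :
    (h.partialMap k).IsStem x ↔ me x = x ∧ h.stem.trunc k x = x := h.mul_trunc_eq_iff k x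

theorem next_partialMap : (h.partialMap k).next = jump (h.stem.trunc k) := h.jump_mul k

theorem vert_partialMap {x y : Fin (N + 1)} :
    (h.partialMap k).vert x = (h.partialMap k).vert y ↔ SameLevel me x y :=
  BlossomingMap.vert_eq_iff.trans h.edge.sameCycle_jump_iff

theorem sameFace_partialMap {x y : Fin (N + 1)} :
    (h.partialMap k).SameFace x y ↔ SameLevel (h.stem.trunc k) x y := by
  rw [BlossomingMap.SameFace, next_partialMap, (h.stem.noncrossing_trunc k).sameCycle_jump_iff]

theorem localClosure_partialMap {b c : Fin (N + 1)} (hb : b < mb b) (hc : mb b = c) :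
    BlossomingMap.LocalClosure (h.partialMap c) (h.partialMap (c + 1)) := by
  have hbc : b < c := hc ▸ hb
  have hcb : mb c = b := by rw [← hc, h.stem.apply_apply]
  have hme_b : me b = b := h.edge_eq hb.ne'
  have hme_c : me c = c := h.edge_eq (by rw [hcb]; exact hbc.ne)
  have htb : h.stem.trunc c b = b := by
    rw [trunc_apply, if_neg]
    rintro ⟨-, h1⟩
    rw [hc] at h1
    exact lt_irrefl _ h1
  have htc : h.stem.trunc c c = c := by
    rw [trunc_apply, if_neg]
    exact fun h => lt_irrefl _ h.1
  have hsb : (h.partialMap c).IsStem b := (h.isStem_partialMap _).2 ⟨hme_b, htb⟩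
  have hsc : (h.partialMap c).IsStem c := (h.isStem_partialMap _).2 ⟨hme_c, htc⟩
  refine ⟨b, c, hsb, Or.inr hb, hsc, ?_, ?_, rfl, ?_, rfl, ?_⟩
  · rintro (h1 | h1)
    · exact h1.ne hme_c
    · rw [hcb] at h1; exact lt_asymm h1 hbc
  -- The walk from `b` to `c` advances strictly, and by noncrossing every stem passed on the way has
  -- its partner before `c`, so it is already merged.
  · obtain ⟨l, hl, hlt⟩ := (h.stem.noncrossing_trunc c).exists_pow_jump hbc.le
      (sameLevel_of_forall_not (h.not_inArc_trunc c hme_b htb) (h.not_inArc_trunc c hme_c htc))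
    rw [next_partialMap]
    refine ⟨l, hl, fun i hi0 hil hs => ?_⟩
    obtain ⟨h1, h2⟩ := hlt i hil
    have h3 := h1 hi0
    generalize (jump (h.stem.trunc c) ^ i) b = y at hs h2 h3
    have h4 := h.stem.nested b y h3 (by rwa [hc])
    rw [hc] at h4
    obtain ⟨h5, h6⟩ := (h.isStem_partialMap _).1 hs
    rw [h.stem.trunc_of_lt h2 h4.2] at h6
    exact (h.edge_eq_iff y).1 h5 h6
  · change me * h.stem.trunc (c + 1) = Equiv.swap b c * (me * h.stem.trunc c)
    ext x
    congr 1
    by_cases hxb : x = b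
    · subst hxb
      rw [Equiv.Perm.mul_apply, Equiv.Perm.mul_apply, h.mul_trunc_of_stem _ hme_b, htb,
        Equiv.swap_apply_left, h.stem.trunc_of_lt (Nat.lt_succ_of_lt hbc)
        (by rw [hc]; exact Nat.lt_succ_self _), hc, hme_c]
    · by_cases hxc : x = c
      · subst hxc
        rw [Equiv.Perm.mul_apply, Equiv.Perm.mul_apply, h.mul_trunc_of_stem _ hme_c, htc,
          Equiv.swap_apply_right, h.stem.trunc_of_lt (Nat.lt_succ_self _)
          (by rw [hcb]; exact Nat.lt_succ_of_lt hbc), hcb, hme_b]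
      · have hmc : mb x ≠ c := fun h1 => hxb (by rw [← h.stem.apply_apply x, h1, hcb])
        have htx : h.stem.trunc (c + 1) x = h.stem.trunc c x := by
          have h1 : x.val ≠ c.val := fun h => hxc (Fin.ext h)
          have h2 : (mb x).val ≠ c.val := fun h => hmc (Fin.ext h)
          rw [trunc_apply, trunc_apply]
          exact if_congr (by omega) rfl rfl
        rw [Equiv.Perm.mul_apply, Equiv.Perm.mul_apply, Equiv.swap_apply_of_ne_of_ne, htx,
          Equiv.Perm.mul_apply]
        · intro h1
          exact hxb ((me * h.stem.trunc c).injective (h1.trans hsb.symm))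
        · intro h1
          exact hxc ((me * h.stem.trunc c).injective (h1.trans hsc.symm))
  · rw [sameFace_partialMap]
    -- By noncrossing, an arc above `b` would end after `c`, so it is not yet in the truncation.
    refine sameLevel_of_forall_not not_inArc_zero fun d hd => ?_
    obtain ⟨h1, h2⟩ := hd
    rcases h.stem.trunc_eq_or (c + 1) d with ⟨h3, h4, h5⟩ | ⟨h3, h4⟩
    · rw [h3] at h1
      rcases h2.eq_or_lt with rfl | h2
      · exact lt_asymm h1 hb
      · have h6 := h.stem.val_nested d b h1 h2
        rw [hc] at h6
        omega
    · rw [h3] at h1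
      exact absurd (h1.trans_le h2) (lt_irrefl _)

/-- Closing stems are treated from left to right; passing any other letter does not change the
truncation. -/
theorem reflTransGen_localClosure (hk : k ≤ N + 1) :
    Relation.ReflTransGen BlossomingMap.LocalClosure (h.partialMap 0) (h.partialMap k) := by
  induction k with
  | zero => exact Relation.ReflTransGen.refl
  | succ k ih =>
    obtain ⟨c, rfl⟩ : ∃ c : Fin (N + 1), c.val = k := ⟨⟨k, hk⟩, rfl⟩
    by_cases hc : mb c < c
    · exact (ih (by omega)).tail (h.localClosure_partialMap (b := mb c)
        (by rwa [h.stem.apply_apply]) (h.stem.apply_apply c))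
    · have htrunc : h.stem.trunc (c + 1) = h.stem.trunc c := by
        ext x
        congr 1
        rw [trunc_apply, trunc_apply]
        have h1 : x.val = c.val → (mb x).val = (mb c).val := (val_eq_iff mb x c).1
        have h2 : (mb x).val = c.val → x.val = (mb c).val := (h.stem.val_eq_apply_iff x c).1
        have h3 : ¬ (mb c).val < c.val := hc
        by_cases h4 : x = mb x
        · simp [← h4]
        · have h5 : x.val ≠ (mb x).val := fun h => h4 (Fin.ext h)
          exact if_congr (by omega) rfl rfl
      have : h.partialMap (c + 1) = h.partialMap c := by
        simp only [partialMap, htrunc]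
      rw [this]
      exact ih (by omega)

end

end IsBipolarPair

theorem Noncrossing.val_pow_jump_one {i : ℕ} (hi : i < N + 1) :
    ((jump (1 : Equiv.Perm (Fin (N + 1))) ^ i) 0).val = i := by
  induction i with
  | zero => rfl
  | succ i ih =>
    rw [pow_succ', Equiv.Perm.mul_apply]
    have h1 := ih (by omega)
    have h2 := val_jump 1 ((jump (1 : Equiv.Perm (Fin (N + 1))) ^ i) 0)
    rw [Equiv.Perm.one_apply] at h2
    omega

/-! ### The blossoming tree and its contour word -/

namespace IsBipolarPair

theorem isStem_tree (h : IsBipolarPair me mb) {x : Fin (N + 1)} :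
    (h.partialMap 0).IsStem x ↔ me x = x := by
  rw [h.isStem_partialMap, h.stem.trunc_zero]
  simp

theorem opp_tree (h : IsBipolarPair me mb) (x : Fin (N + 1)) : (h.partialMap 0).opp x = me x := by
  change (me * h.stem.trunc 0) x = me x
  rw [h.stem.trunc_zero, mul_one]

theorem isTree_tree (h : IsBipolarPair me mb) : (h.partialMap 0).IsTree := by
  intro x y
  rw [h.sameFace_partialMap, h.stem.trunc_zero]
  exact sameLevel_of_forall_not (fun d hd => lt_irrefl _ (hd.1.trans_le hd.2))
    (fun d hd => lt_irrefl _ (hd.1.trans_le hd.2))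

/-- The innermost arc above `x` ends in a dart of the same vertex that is directed to the parent,
and starts before `x`; hence an induction on positions. -/
theorem accessible_tree (h : IsBipolarPair me mb) :
    (h.partialMap 0).Accessible ((h.partialMap 0).vert 0) := by
  intro u
  induction u using Quotient.inductionOn with
  | _ x =>
    change Relation.ReflTransGen _ ((h.partialMap 0).vert x) _
    induction hx : x.val using Nat.strong_induction_on generalizing x with
    | _ n ih =>
      subst hx
      by_cases hx : ∃ d, InArc me d x
      · obtain ⟨d, hd, hmin⟩ := exists_min_inArc hx
        have hlt : me d < d := hd.1.trans_le hd.2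
        rw [(h.vert_partialMap 0).2 (h.edge.sameLevel_of_min hd hmin)]
        refine Relation.ReflTransGen.head ?_ (ih _ hd.1 (me d) rfl)
        have := BlossomingMap.arc_of_out (B := h.partialMap 0) (x := d)
          (fun hs => hlt.ne (h.isStem_tree.1 hs)) (Or.inl hlt)
        rwa [h.opp_tree] at this
      · rw [(h.vert_partialMap 0).2 (sameLevel_of_forall_not (not_exists.1 hx) not_inArc_zero)]

theorem contourLetter_tree (h : IsBipolarPair me mb) (x : Fin (N + 1)) :
    (h.partialMap 0).contourLetter 0 x =
      if me x = x then if x < mb x then Letter.b else Letter.bbar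
      else if me x < x then Letter.ebar else Letter.e := by
  have hpow : ∀ i, i < N + 1 → (((h.partialMap 0).next ^ i) 0).val = i := by
    intro i hi
    rw [next_partialMap, h.stem.trunc_zero, val_pow_jump_one hi]
  have hx : ((h.partialMap 0).next ^ x.val) 0 = x := Fin.ext (hpow _ x.2)
  have hex : (∃ j < x.val, ((h.partialMap 0).next ^ j) 0 = me x) ↔ me x < x := by
    constructor
    · rintro ⟨j, hj, h1⟩
      rw [← h1, Fin.lt_def, hpow j (by omega)]
      exact hj
    · intro h1
      exact ⟨(me x).val, h1, Fin.ext (hpow _ (me x).2)⟩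
  have hout : (h.partialMap 0).out x ↔ me x < x ∨ x < mb x := Iff.rfl
  simp only [BlossomingMap.contourLetter, hx, h.isStem_tree, h.opp_tree, hex, hout]
  by_cases h1 : me x = x <;> simp [h1]

/-! ### The closure -/

section

variable (h : IsBipolarPair me mb)

theorem not_isStem_map (x : Fin (N + 1)) : ¬ (h.partialMap (N + 1)).IsStem x := by
  rw [h.isStem_partialMap, h.stem.trunc_of_le le_rfl]
  exact fun h1 => (h.edge_eq_iff x).1 h1.1 h1.2

theorem opp_map_of_edge {x : Fin (N + 1)} (hx : me x ≠ x) :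
    (h.partialMap (N + 1)).opp x = me x := h.mul_trunc_of_edge _ hx

theorem opp_map_of_stem {x : Fin (N + 1)} (hx : mb x ≠ x) :
    (h.partialMap (N + 1)).opp x = mb x := by
  refine (h.mul_trunc_of_stem _ (h.edge_eq hx)).trans ?_
  rw [h.stem.trunc_of_le le_rfl]

/-- The end of the innermost arc above `x`. -/
noncomputable def rank (m : Equiv.Perm (Fin (N + 1))) (x : Fin (N + 1)) : ℕ :=
  sInf {r | (∃ d, InArc m d x ∧ d.val = r) ∨ N + 1 = r}

theorem rank_le {m : Equiv.Perm (Fin (N + 1))} {x d : Fin (N + 1)} (hd : InArc m d x) :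
    rank m x ≤ d := Nat.sInf_le (Or.inl ⟨d, hd, rfl⟩)

theorem rank_cases (m : Equiv.Perm (Fin (N + 1))) (x : Fin (N + 1)) :
    (∃ d, InArc m d x ∧ d.val = rank m x) ∨ N + 1 = rank m x :=
  Nat.sInf_mem (s := {r | (∃ d, InArc m d x ∧ d.val = r) ∨ N + 1 = r}) ⟨N + 1, Or.inr rfl⟩

theorem rank_eq_of_sameLevel {m : Equiv.Perm (Fin (N + 1))} {x y : Fin (N + 1)}
    (hxy : SameLevel m x y) : rank m x = rank m y := by
  simp only [rank, hxy _]

/-- `rank` orders the vertices by their `ebar`, with the root last at `N + 1`. Tree edges go up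
since arcs are nested. For an edge that comes from a stem, the first `ebar` after the stem closes an
arc above it, and comes before the closing partner. -/
theorem rank_lt {x : Fin (N + 1)} (hx : (h.partialMap (N + 1)).out x) :
    rank me x < rank me ((h.partialMap (N + 1)).opp x) := by
  rcases (show me x < x ∨ x < mb x from hx) with hx | hx
  · rw [h.opp_map_of_edge hx.ne]
    have h1 : rank me x ≤ x := rank_le ⟨hx, le_rfl⟩
    rcases rank_cases me (me x) with ⟨d, hd, h2⟩ | h2
    · have h3 := h.edge.val_nested' d x
      have h4 := h.edge.val_eq_apply_iff x d
      have h5 := hx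
      simp only [inArc_def, Fin.lt_def] at *
      omega
    · omega
  · rw [h.opp_map_of_stem hx.ne']
    obtain ⟨d, h1, h2, h3, -⟩ := h.exists_first_ebar hx
    have h4 : rank me x ≤ d := rank_le ⟨h3, h1.le⟩
    rcases rank_cases me (mb x) with ⟨d', hd, h5⟩ | h5
    · have h6 := hd.2
      rw [Fin.le_def] at h6
      rw [Fin.lt_def] at h2
      omega
    · omega

theorem acyclic_map : (h.partialMap (N + 1)).Acyclic := by
  let f : (h.partialMap (N + 1)).Vertex → ℕ := Quotient.lift (rank me) fun x y hxy =>
    rank_eq_of_sameLevel ((h.vert_partialMap (N + 1)).1 (Quotient.sound hxy))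
  have hf : ∀ u v, (h.partialMap (N + 1)).Arc u v → f u < f v := by
    rintro u v ⟨x, -, hx, rfl, rfl⟩
    exact h.rank_lt hx
  have hf' : ∀ u v, Relation.TransGen (h.partialMap (N + 1)).Arc u v → f u < f v := by
    intro u v huv
    induction huv with
    | single h1 => exact hf _ _ h1
    | tail _ h1 ih => exact ih.trans (hf _ _ h1)
  exact fun u hu => lt_irrefl _ (hf' u u hu)

theorem nonSeparable_map : (h.partialMap (N + 1)).NonSeparable := by
  intro x y hv hf
  rw [h.vert_partialMap] at hv
  rw [h.sameFace_partialMap, h.stem.trunc_of_le le_rfl] at hf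
  exact h.eq_of_sameLevel hv hf

/-- A non-root vertex has an outgoing `ebar`. The root vertex has none, and an opening stem there
would lie below an arc by `exists_first_ebar`. -/
theorem isSink_map_iff (v : (h.partialMap (N + 1)).Vertex) :
    (h.partialMap (N + 1)).IsSink v ↔ v = (h.partialMap (N + 1)).vert 0 := by
  constructor
  · intro hv
    induction v using Quotient.inductionOn with
    | _ x =>
      change (h.partialMap (N + 1)).vert x = _
      by_cases hx : ∃ d, InArc me d x
      · exfalso
        obtain ⟨d, hd, hmin⟩ := exists_min_inArc hx
        refine BlossomingMap.IsSink.not_out (root := d) ?_ (h.not_isStem_map d)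
          (Or.inl (hd.1.trans_le hd.2))
        rwa [← (h.vert_partialMap _).2 (h.edge.sameLevel_of_min hd hmin)]
      · exact (h.vert_partialMap _).2 (sameLevel_of_forall_not (not_exists.1 hx) not_inArc_zero)
  · rintro rfl ⟨u, x, -, hx, hv, -⟩
    rw [h.vert_partialMap] at hv
    rcases (show me x < x ∨ x < mb x from hx) with hx | hx
    · exact not_inArc_zero _ ((hv x).1 ⟨hx, le_rfl⟩)
    · obtain ⟨d, h1, -, h2, -⟩ := h.exists_first_ebar hx
      exact not_inArc_zero _ ((hv d).1 ⟨h2, h1.le⟩)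

theorem one_lt_val_zero (h : IsBipolarPair me mb) : 1 < (me 0).val := by
  have h1 : 0 < (me 0).val := h.zero_lt
  have h2 : (me 0).val ≠ 1 := by
    intro h2
    have h3 := h.stem_eq (x := me 0) (by rw [h.edge.apply_apply]; exact h.zero_lt.ne)
    have h4 := h.one_lt _ h2
    rw [h3] at h4
    exact lt_irrefl _ h4
  omega

/-- Applied to the `b` in second position, `exists_first_ebar` shows that the first `ebar` of the
word closes the root edge. Before it no `bbar` can occur, by (4), and no second `e`, whose `ebar`
would come earlier; only letters `b` remain. -/
theorem isSource_vert_me_zero :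
    (h.partialMap (N + 1)).IsSource ((h.partialMap (N + 1)).vert (me 0)) := by
  rintro ⟨u, x, hx, hox, -, hv⟩
  have hlt := h.one_lt_val_zero
  have hoy : ¬ (h.partialMap (N + 1)).out ((h.partialMap (N + 1)).opp x) :=
    fun ho => (BlossomingMap.out_opp_iff hx).1 ho hox
  generalize (h.partialMap (N + 1)).opp x = y at hv hoy
  rw [h.vert_partialMap] at hv
  obtain ⟨p, hp⟩ : ∃ p : Fin (N + 1), p.val = 1 := ⟨⟨1, lt_trans hlt (me 0).2⟩, rfl⟩
  have hpb := h.one_lt p hp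
  obtain ⟨d, h1, h2, h3, hmin⟩ := h.exists_first_ebar hpb
  have hd0 : me d = 0 := Fin.ext (Nat.lt_one_iff.1 ((Fin.lt_def.1 h3).trans_eq hp))
  have hd : d = me 0 := by rw [← hd0, h.edge.apply_apply]
  subst hd
  obtain ⟨h4, h5⟩ := (hv (me 0)).2 ⟨by rw [h.edge.apply_apply]; exact h.zero_lt, le_rfl⟩
  rw [h.edge.apply_apply] at h4
  have hy : ¬ (me y < y ∨ y < mb y) := hoy
  push Not at hy
  have hyp : p < y := by
    rw [Fin.lt_def, hp]
    rw [Fin.lt_def] at h4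
    have : y ≠ p := by
      rintro rfl
      exact absurd hpb (not_lt.2 hy.2)
    have : y.val ≠ p.val := fun h => this (Fin.ext h)
    simp at h4
    omega
  have hyd : y < me 0 := by
    refine h5.lt_of_ne ?_
    rintro rfl
    rw [h.edge.apply_apply] at hy
    exact absurd h.zero_lt (not_lt.2 hy.1)
  by_cases hey : me y = y
  · have hby : mb y < y := hy.2.lt_of_ne ((h.edge_eq_iff y).1 hey)
    obtain ⟨k, h6, h7, h8⟩ := h.exists_ebar_lt hyp hpb hby
    exact absurd (hmin k h6 h8) (not_le.2 (h7.trans hyd))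
  · have hey' : y < me y := hy.1.lt_of_ne (Ne.symm hey)
    have h6 := h.edge.nested 0 y h4 hyd
    exact absurd (hmin (me y) (hyp.trans hey') (by rwa [h.edge.apply_apply]))
      (not_le.2 h6.2)

/-- The letter that follows a letter `e` is `e` or `b̄`, except at the start of the word. -/
theorem not_out_jump {d : Fin (N + 1)} (hd : me d < d) (h0 : me d ≠ 0) :
    ¬ (h.partialMap (N + 1)).out (jump me d) := by
  have hpos : 0 < me d := Fin.pos_iff_ne_zero.2 h0
  have hval : (jump me d).val = (me d).val + 1 := by
    have h1 := val_jump me d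
    have h2 : (me d).val < d.val := hd
    omega
  have hlt : me d < jump me d := by rw [Fin.lt_def]; omega
  have hup : me d < me (me d) := by rwa [h.edge.apply_apply]
  rintro (h1 | h1)
  · obtain ⟨k, h2, h3, -⟩ := h.exists_bbar_lt hpos hlt hup h1
    rw [Fin.lt_def] at h2 h3
    omega
  · obtain ⟨r, h2, -, h3, hmin⟩ := h.exists_first_ebar h1
    obtain ⟨k, h4, h5, h6⟩ := h.exists_bbar_lt hpos (hlt.trans h2) hup (h3.trans h2)
    have h7 : jump me d < k := by
      refine lt_of_le_of_ne ?_ ?_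
      · rw [Fin.lt_def] at h4; rw [Fin.le_def]; omega
      · rintro h7
        rw [← h7] at h6
        exact lt_asymm h1 h6
    obtain ⟨s, h8, h9, h10⟩ := h.exists_ebar_lt h7 h1 h6
    exact absurd (hmin s h8 h10) (not_le.2 (h9.trans h5))

/-- Any other non-root vertex is entered by an `e` that is not the first letter, and the next dart
there is incoming by `not_out_jump`; the root vertex has the incoming root edge. -/
theorem isSource_map_iff (v : (h.partialMap (N + 1)).Vertex) :
    (h.partialMap (N + 1)).IsSource v ↔ v = (h.partialMap (N + 1)).vert (me 0) := by
  constructor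
  · intro hv
    induction v using Quotient.inductionOn with
    | _ x =>
      change (h.partialMap (N + 1)).vert x = _
      change (h.partialMap (N + 1)).IsSource ((h.partialMap (N + 1)).vert x) at hv
      by_cases hx : ∃ d, InArc me d x
      · obtain ⟨d, hd, hmin⟩ := exists_min_inArc hx
        have hlt : me d < d := hd.1.trans_le hd.2
        have hxd := h.edge.sameLevel_of_min hd hmin
        rw [(h.vert_partialMap _).2 hxd]
        by_cases h0 : me d = 0
        · rw [← h0, h.edge.apply_apply]
        · exfalso
          refine h.not_out_jump hlt h0 (BlossomingMap.IsSource.out ?_ (h.not_isStem_map _))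
          rwa [← (h.vert_partialMap _).2 (hxd.trans (h.edge.sameLevel_jump d))]
      · exfalso
        rw [(h.vert_partialMap _).2
          (sameLevel_of_forall_not (not_exists.1 hx) not_inArc_zero)] at hv
        rcases (show me 0 < 0 ∨ 0 < mb 0 from hv.out (h.not_isStem_map 0)) with h1 | h1
        · exact Fin.not_lt_zero _ h1
        · rw [h.stem_eq h.zero_lt.ne'] at h1
          exact lt_irrefl _ h1
  · rintro rfl
    exact h.isSource_vert_me_zero

theorem two_le_numEdges_map : 2 ≤ (h.partialMap (N + 1)).numEdges := by
  have hlt := h.one_lt_val_zero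
  obtain ⟨p, hp⟩ : ∃ p : Fin (N + 1), p.val = 1 := ⟨⟨1, lt_trans hlt (me 0).2⟩, rfl⟩
  have hpb := h.one_lt p hp
  have hne : p ≠ me 0 := by rintro rfl; omega
  have : Nontrivial {d : Fin (N + 1) // ¬ (h.partialMap (N + 1)).IsStem d ∧
      (h.partialMap (N + 1)).out d} :=
    ⟨⟨p, h.not_isStem_map _, Or.inr hpb⟩,
      ⟨me 0, h.not_isStem_map _, Or.inl (by rw [h.edge.apply_apply]; exact h.zero_lt)⟩,
      fun heq => hne (congrArg Subtype.val heq)⟩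
  exact Finite.one_lt_card_iff_nontrivial.2 this

theorem isPlaneBipolar_map : (h.partialMap (N + 1)).IsPlaneBipolar 0 where
  no_stem := h.not_isStem_map
  root_outer := Equiv.Perm.SameCycle.refl _ _
  nonSeparable := h.nonSeparable_map
  two_le_numEdges := h.two_le_numEdges_map
  acyclic := h.acyclic_map
  source_iff v := by
    rw [h.opp_map_of_edge h.zero_lt.ne']
    exact h.isSource_map_iff v
  sink_iff := h.isSink_map_iff

theorem isBipolarTree : (h.partialMap 0).IsBipolarTree 0 :=
  ⟨h.partialMap (N + 1), h.isPlaneBipolar_map, h.isTree_tree, h.accessible_tree,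
    h.reflTransGen_localClosure _ le_rfl, fun ⟨_, b, _, hb, _⟩ => h.not_isStem_map b hb⟩

end

end IsBipolarPair

/-! ### From words to maps, and the equivalence -/

theorem List.getElem?_ofFn_eq_some {α : Type} {n : ℕ} {l : Fin n → α} {i : ℕ} {a : α} :
    (List.ofFn l)[i]? = some a ↔ ∃ h : i < n, l ⟨i, h⟩ = a := by
  rw [List.getElem?_eq_some_iff]
  simp

/-- A word that satisfies the five conditions comes from a pair of matchings. -/
theorem exists_isBipolarPair (l : Fin (N + 1) → Letter)
    (h0 : (List.ofFn l)[0]? = some Letter.e) (h1 : (List.ofFn l)[1]? = some Letter.b)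
    (p q : DyckWord) (hp : p.toList = (List.ofFn l).filterMap Letter.edgeStep)
    (hq : q.toList = (List.ofFn l).filterMap Letter.stemStep)
    (h4 : ∀ i j : ℕ, i < j → (List.ofFn l)[i]? = some Letter.b →
      (List.ofFn l)[j]? = some Letter.bbar →
        ∃ k, i ≤ k ∧ k ≤ j ∧ (List.ofFn l)[k]? = some Letter.ebar)
    (h5 : ∀ i j : ℕ, 0 < i → i < j → (List.ofFn l)[i]? = some Letter.e →
      (List.ofFn l)[j]? = some Letter.ebar →
        ∃ k, i ≤ k ∧ k ≤ j ∧ (List.ofFn l)[k]? = some Letter.bbar) :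
    ∃ me mb : Equiv.Perm (Fin (N + 1)), IsBipolarPair me mb ∧ ∀ x,
      l x = if me x = x then if x < mb x then Letter.b else Letter.bbar
        else if me x < x then Letter.ebar else Letter.e := by
  obtain ⟨me, hme, he⟩ := exists_noncrossing_of_dyckWord _ l p hp
  obtain ⟨mb, hmb, hb⟩ := exists_noncrossing_of_dyckWord _ l q hq
  have hl : ∀ x, (l x = Letter.e ∧ x < me x ∧ mb x = x) ∨ (l x = Letter.ebar ∧ me x < x ∧ mb x = x) ∨
      (l x = Letter.b ∧ x < mb x ∧ me x = x) ∨ (l x = Letter.bbar ∧ mb x < x ∧ me x = x) := by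
    intro x
    have h1 := he x
    have h2 := hb x
    rcases h : l x <;> simp [h, Letter.edgeStep, Letter.stemStep] at h1 h2 ⊢ <;> simp [h1, h2]
  have hxe : ∀ x, l x = Letter.e ↔ x < me x := by
    intro x; rcases hl x with h | h | h | h <;> simp [h, h.2.1.le]
  have hxE : ∀ x, l x = Letter.ebar ↔ me x < x := by
    intro x; rcases hl x with h | h | h | h <;> simp [h, h.2.1.le]
  have hxb : ∀ x, l x = Letter.b ↔ x < mb x := by
    intro x; rcases hl x with h | h | h | h <;> simp [h, h.2.1.le]
  have hxB : ∀ x, l x = Letter.bbar ↔ mb x < x := by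
    intro x; rcases hl x with h | h | h | h <;> simp [h, h.2.1.le]
  simp only [List.getElem?_ofFn_eq_some] at h0 h1 h4 h5
  refine ⟨me, mb, ⟨hme, hmb, fun x => ?_, ?_, fun x hx => ?_, fun i j hij hi hj => ?_,
    fun i j hi0 hij hi hj => ?_⟩, fun x => ?_⟩
  · rcases hl x with h | h | h | h <;> simp [h, h.2.1.ne, h.2.1.ne']
  · obtain ⟨_, h0⟩ := h0
    exact (hxe _).1 h0
  · obtain ⟨h, h1⟩ := h1
    have : x = ⟨1, h⟩ := Fin.ext hx
    rw [this]
    exact (hxb _).1 h1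
  · obtain ⟨k, h6, h7, hk, h8⟩ := h4 i j hij ⟨i.2, (hxb i).2 hi⟩ ⟨j.2, (hxB j).2 hj⟩
    exact ⟨⟨k, hk⟩, h6, h7, (hxE _).1 h8⟩
  · obtain ⟨k, h6, h7, hk, h8⟩ := h5 i j hi0 hij ⟨i.2, (hxe i).2 hi⟩ ⟨j.2, (hxE j).2 hj⟩
    exact ⟨⟨k, hk⟩, h6, h7, (hxB _).1 h8⟩
  · rcases hl x with h | h | h | h <;> simp [h, h.2.1.ne, h.2.1.ne', not_lt.2 h.2.1.le]

/-- Positions in words are numbered from 0 here. -/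
theorem lemma4 (w : List Letter) :
    (∃ (D : Type) (_ : Fintype D) (_ : DecidableEq D) (T : BlossomingMap D) (root : D),
        T.IsBipolarTree root ∧ T.contourWord root = w) ↔
      (w[0]? = some Letter.e ∧ w[1]? = some Letter.b) ∧
      (∃ p : DyckWord, p.toList = w.filterMap Letter.edgeStep) ∧
      (∃ p : DyckWord, p.toList = w.filterMap Letter.stemStep) ∧
      (∀ i j : ℕ, i < j → w[i]? = some Letter.b → w[j]? = some Letter.bbar →
        ∃ k, i ≤ k ∧ k ≤ j ∧ w[k]? = some Letter.ebar) ∧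
      (∀ i j : ℕ, 0 < i → i < j → w[i]? = some Letter.e → w[j]? = some Letter.ebar →
        ∃ k, i ≤ k ∧ k ≤ j ∧ w[k]? = some Letter.bbar) := by
  constructor
  · rintro ⟨D, _, _, T, root, ⟨M, hM, hO⟩, rfl⟩
    exact ⟨hO.contourWord_zero_one hM, hO.exists_dyckWord_edge, hO.exists_dyckWord_stem hM,
      fun i j hij => hO.exists_ebar_between hM hij,
      fun i j hi hij => hO.exists_bbar_between hM hi hij⟩
  · rintro ⟨⟨h0, h1⟩, ⟨p, hp⟩, ⟨q, hq⟩, h4, h5⟩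
    -- The first letter exists, so the length is some `N + 1`, as the cyclic structure of the
    -- positions requires.
    obtain ⟨N, l, rfl⟩ : ∃ (N : ℕ) (l : Fin (N + 1) → Letter), w = List.ofFn l := by
      rcases w with _ | ⟨a, w⟩
      · simp at h0
      · exact ⟨w.length, (a :: w).get, (List.ofFn_get _).symm⟩
    obtain ⟨me, mb, h, hl⟩ := exists_isBipolarPair l h0 h1 p q hp hq h4 h5
    refine ⟨Fin (N + 1), inferInstance, inferInstance, h.partialMap 0, 0, h.isBipolarTree, ?_⟩
    refine List.ext_getElem (by simp [BlossomingMap.contourWord]) fun i h2 h3 => ?_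
    have h6 : i < N + 1 := by simpa using h3
    have h7 := h.contourLetter_tree ⟨i, h6⟩
    rw [← hl] at h7
    rw [List.getElem_ofFn, ← h7]
    simp [BlossomingMap.contourWord]
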